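/- **Setting.** All filters are causal, linear, time-invariant and have real impulse responses $(H_t)_{t\ge 0}$, with transfer function $H(z)=\sum_{t\ge0}H_tz^{-t}$; $\|H\|_2^2=\sum_t \mathrm{Tr}(H_t^{T}H_t)$ is the squared $\mathcal H_2$ norm, and a filter is called stable if its $\mathcal H_2$ norm is finite. $H(e^{j\omega})$ is the frequency response, defined for almost every $\omega$ as the sum of the series in $L^2$ of the unit circle. Let $k_1>0$, $\epsilon>0$, $0<\delta<1$, let $\mathcal Q(x)=\frac1{\sqrt{2\pi}}\int_x^\infty e^{-v^2/2}dv$, $K=\mathcal Q^{-1}(\delta)$ and $\kappa_{\delta,\epsilon}=\frac{1}{2\epsilon}\left(K+\sqrt{K^2+2\epsilon}\right)$. Two scalar input signals $u,u':\mathbb N\to\mathbb R$ are adjacent if $u'-u$ is a single impulse $\alpha\delta_{\tau}$, $\tau \in \mathbb N$, with $|\alpha|\le k_1$; the $\ell_2$-sensitivity of a single-input filter $G$ is $\Delta_2G=\sup\|Gu-Gu'\|_2$ over adjacent $u,u'$. Let $F$ be a filter with one input and $p$ outputs. Given a stable pre-filter $G$ with one input and $q$ outputs and a causal left inverse $L$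 of $G$ (that is, $L(z)G(z)=1$), the zero-forcing equalization (ZFE) mechanism publishes $\hat y=FL(Gu+w)$, where $w$ is a $q$-dimensional Gaussian white noise with covariance matrix $\kappa_{\delta,\epsilon}^2(\Delta_2G)^2I_q$. Its mean square error is $$e^{ZFE}_{mse}(G)=\lim_{T\to\infty}\frac1T\sum_{t=0}^{T-1}\mathbb E\left[|(Fu)_t-\hat y_t|_2^2\right]\in[0,\infty].$$ **Theorem.** Let $F$ be a single-input, multiple-output filter with $\|F\|_2<\infty$. For every $q$, every stable filter $G$ with one input and $q$ outputs, and every causal left inverse $L$ of $G$, the limit $e^{ZFE}_{mse}(G)$ exists in $[0,\infty]$, does not depend on the input $u$, and satisfies $$e^{ZFE}_{mse}(G)\ \ge\ k_1^2\,\kappa_{\delta,\epsilon}^2\left(\frac1{2\pi}\int_{-\pi}^{\pi}|F(e^{j\omega})|_2\,d\omega\right)^2 .$$ If moreover $F$ satisfies the Paley–Wiener condition $\frac1{2\pi}\int_{-\pi}^{\pi}\ln|F(e^{j\omega})|_2\,d\omega>-\infty$, then this lower bound is attained by some stable minimum phase filter $G$ with one input and one output, with its causal inverse $L=1/G$, such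 that $|G(e^{j\omega})|^2=|F(e^{j\omega})|_2$ for almost every $\omega\in[-\pi,\pi)$. Here minimum phase means that $G$ is an outer function of $|z|>1$: $\ln|G(e^{j\omega})|$ is integrable and, for some constant $c$ with $|c|=1$ and all $|z|>1$, $$G(z)=c\,\exp\left(\frac1{2\pi}\int_{-\pi}^{\pi}\frac{z+e^{j\omega}}{z-e^{j\omega}}\ln|G(e^{j\omega})|\,d\omega\right).$$ -/

import Mathlib

open MeasureTheory ProbabilityTheory Filter Topology

universe u

noncomputable section

namespace ZFE

/-! ### Causal linear time-invariant filters and signals -/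

/-- A signal with `m` real components, indexed by the times `t = 0, 1, 2, …`. -/
abbrev Signal (m : ℕ) : Type := ℕ → Fin m → ℝ

/-- A causal LTI filter with `m` inputs and `p` outputs and real coefficients, given by its impulse
response `H 0, H 1, H 2, …` (a sequence of `p × m` matrices). Its transfer function is
`H(z) = ∑ t, H t * z ^ (-t)`. -/
abbrev CausalFilter (m p : ℕ) : Type := ℕ → Matrix (Fin p) (Fin m) ℝ

/-- The output `(H u) t = ∑_{s + r = t} H s (u r)` of the filter `H` on the input signal `u`. -/
def CausalFilter.apply {m p : ℕ} (H : CausalFilter m p) (u : Signal m) : Signal p :=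
  fun t => ∑ x ∈ Finset.HasAntidiagonal.antidiagonal t, (H x.1).mulVec (u x.2)

/-- The cascade `K H` (first `H`, then `K`); its transfer function is the product `K(z) H(z)`. -/
def CausalFilter.comp {m q p : ℕ} (K : CausalFilter q p) (H : CausalFilter m q) :
    CausalFilter m p :=
  fun t => ∑ x ∈ Finset.HasAntidiagonal.antidiagonal t, K x.1 * H x.2

/-- The identity system with `m` inputs. -/
def CausalFilter.one (m : ℕ) : CausalFilter m m := fun t => if t = 0 then 1 else 0

/-- `L` is a (causal) left inverse of `G`: `L(z) G(z) = I`. -/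
def IsLeftInverse {m q : ℕ} (L : CausalFilter q m) (G : CausalFilter m q) : Prop :=
  L.comp G = CausalFilter.one m

/-- The squared Euclidean norm of a real vector. -/
def sqNorm {p : ℕ} (x : Fin p → ℝ) : ℝ := ∑ i, x i ^ 2

/-- The `ℓ₂` norm of a signal, possibly infinite. -/
def signalNorm {p : ℕ} (y : Signal p) : ENNReal :=
  (∑' t, ENNReal.ofReal (sqNorm (y t))) ^ (1 / 2 : ℝ)

/-- The `H₂` norm of a filter, possibly infinite: `‖H‖₂² = ∑ t, Tr ((H t)ᵀ (H t))`. -/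
def h2Norm {m p : ℕ} (H : CausalFilter m p) : ENNReal :=
  (∑' t, ENNReal.ofReal (∑ i, ∑ j, H t i j ^ 2)) ^ (1 / 2 : ℝ)

/-- A causal filter is stable if its impulse response has finite energy. This is implied by an
absolutely summable impulse response, and is what makes the sensitivity of the filter finite. -/
def IsStableFilter {m p : ℕ} (H : CausalFilter m p) : Prop := h2Norm H < ⊤

/-! ### Frequency domain -/

instance factTwoPiPos : Fact (0 < 2 * Real.pi) := ⟨Real.two_pi_pos⟩

/-- The entry `(i, j)` of the frequency response, `H(e^{jω}) = ∑ t, H t * e^{-jωt}`, as an element of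
`L²` of the circle `ℝ / 2πℤ` (the series converges in `L²` when `H` has finite `H₂` norm). -/
def freqLp {m p : ℕ} (H : CausalFilter m p) (i : Fin p) (j : Fin m) :
    Lp ℂ 2 (AddCircle.haarAddCircle (T := 2 * Real.pi)) :=
  ∑' t : ℕ, (H t i j : ℂ) • fourierLp 2 (-(t : ℤ))

/-- The frequency response `H(e^{jω})` at the angular frequency `ω`, defined for almost every `ω`. -/
def freqResponse {m p : ℕ} (H : CausalFilter m p) (ω : ℝ) : Matrix (Fin p) (Fin m) ℂ :=
  Matrix.of fun i j => freqLp H i j (ω : AddCircle (2 * Real.pi))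

/-- The Euclidean norm `|F(e^{jω})|₂` of the frequency response of a single-input filter. -/
def freqNorm {p : ℕ} (F : CausalFilter 1 p) (ω : ℝ) : ℝ :=
  Real.sqrt (∑ i, ‖freqResponse F ω i 0‖ ^ 2)

/-- The Paley–Wiener condition `(1 / 2π) ∫ ln |F(e^{jω})|₂ dω > -∞`, where `ln 0 = -∞`. The positive
part of `ln |F(e^{jω})|₂` is always integrable, as `|F(e^{jω})|₂` is. -/
def PaleyWiener {p : ℕ} (F : CausalFilter 1 p) : Prop :=
  (∀ᵐ ω ∂volume.restrict (Set.Ico (-Real.pi) Real.pi), 0 < freqNorm F ω) ∧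
    IntegrableOn (fun ω => Real.log (freqNorm F ω)) (Set.Ico (-Real.pi) Real.pi)

/-- A single-input single-output filter `G` is minimum phase if its transfer function is an outer
function of the exterior `|z| > 1` of the unit disc:
`G(z) = c exp ((1 / 2π) ∫ (z + e^{jω}) / (z - e^{jω}) ln |G(e^{jω})| dω)` with `|c| = 1`.
In particular `G(z)` has no zero in `|z| > 1`, nor at infinity. -/
def IsMinimumPhase (G : CausalFilter 1 1) : Prop :=
  PaleyWiener G ∧ ∃ c : ℂ, ‖c‖ = 1 ∧ ∀ z : ℂ, 1 < ‖z‖ →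
    HasSum (fun t : ℕ => (G t 0 0 : ℂ) * z⁻¹ ^ t)
      (c * Complex.exp ((1 / (2 * Real.pi) : ℝ) * ∫ ω in (-Real.pi)..Real.pi,
        (z + Complex.exp (ω * Complex.I)) / (z - Complex.exp (ω * Complex.I)) *
          (Real.log ‖freqResponse G ω 0 0‖ : ℂ)))

/-! ### Adjacency, sensitivity and the scale of the privacy noise -/

/-- Adjacency of input signals: on each input `i`, `u'` differs from `u` by a single impulse, of
height at most `k i` in absolute value. -/
def Adj {m : ℕ} (k : Fin m → ℝ) (u u' : Signal m) : Prop :=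
  ∀ i, ∃ (τ : ℕ) (α : ℝ), |α| ≤ k i ∧ ∀ t, u' t i - u t i = if t = τ then α else 0

/-- The `ℓ₂`-sensitivity `sup_{Adj(u, u')} ‖G u - G u'‖₂`. -/
def sensitivity {m p : ℕ} (k : Fin m → ℝ) (G : CausalFilter m p) : ENNReal :=
  ⨆ (u : Signal m) (u' : Signal m) (_ : Adj k u u'), signalNorm (G.apply u - G.apply u')

/-- The `Q`-function of the standard Gaussian distribution. -/
def gaussianQ (x : ℝ) : ℝ :=
  1 / Real.sqrt (2 * Real.pi) * ∫ v in Set.Ioi x, Real.exp (-v ^ 2 / 2)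

/-- The inverse of the `Q`-function (meaningful on `(0, 1)`). -/
def gaussianQInv (δ : ℝ) : ℝ := Function.invFun gaussianQ δ

/-- `κ_{δ,ε} = (K + √(K² + 2ε)) / (2ε)` with `K = Q⁻¹(δ)`. -/
def kappa (δ ε : ℝ) : ℝ :=
  1 / (2 * ε) * (gaussianQInv δ + Real.sqrt (gaussianQInv δ ^ 2 + 2 * ε))

/-- `w` is a `q`-dimensional Gaussian white noise with covariance matrix `v I`: the variables
`w t i` are independent, each with the centered Gaussian distribution of variance `v`. -/
def IsGaussianWhiteNoise {Ω : Type u} [MeasurableSpace Ω] (P : Measure Ω) {q : ℕ} (v : NNReal)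
    (w : Ω → Signal q) : Prop :=
  iIndepFun (fun (x : ℕ × Fin q) (a : Ω) => w a x.1 x.2) P ∧
    ∀ t i, HasLaw (fun a => w a t i) (gaussianReal 0 v) P

/-! ### The zero-forcing equalization mechanism -/

/-- The output `ŷ = F L (G u + w)` of the zero-forcing equalization mechanism. -/
def output {p q : ℕ} (F : CausalFilter 1 p) (G : CausalFilter 1 q) (L : CausalFilter q 1)
    (u : Signal 1) (w : Signal q) : Signal p :=
  (F.comp L).apply (G.apply u + w)

/-- The variance `κ² (Δ₂ G)²` of the components of the privacy noise. -/
def noiseVariance {q : ℕ} (k₁ δ ε : ℝ) (G : CausalFilter 1 q) : NNReal :=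
  (ENNReal.ofReal (kappa δ ε ^ 2) * sensitivity (fun _ => k₁) G ^ 2).toNNReal

/-- The mean square error of the mechanism with pre-filter `G` and left inverse `L` exists in
`[0, ∞]` and equals `e`: whatever the input signal `u`, and whatever the white noise `w` with the
prescribed variance, `(1 / T) ∑_{t < T} E |(F u)_t - ŷ_t|₂²` tends to `e` as `T → ∞`. -/
def HasMSE {p q : ℕ} (k₁ δ ε : ℝ) (F : CausalFilter 1 p) (G : CausalFilter 1 q)
    (L : CausalFilter q 1) (e : ENNReal) : Prop :=
  ∀ (Ω : Type u) [MeasurableSpace Ω] (P : Measure Ω) [IsProbabilityMeasure P] (w : Ω → Signal q),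
    IsGaussianWhiteNoise P (noiseVariance k₁ δ ε G) w → ∀ s : Signal 1,
      Tendsto (fun T : ℕ => (∑ t ∈ Finset.range T,
          ∫⁻ a, ENNReal.ofReal (sqNorm (F.apply s t - output F G L s (w a) t)) ∂P) / (T : ENNReal))
        atTop (𝓝 e)

/-- The value `k₁² κ² ((1 / 2π) ∫ |F(e^{jω})|₂ dω)²`. -/
def mseBound {p : ℕ} (k₁ δ ε : ℝ) (F : CausalFilter 1 p) : ℝ :=
  k₁ ^ 2 * kappa δ ε ^ 2 *
    (1 / (2 * Real.pi) * ∫ ω in (-Real.pi)..Real.pi, freqNorm F ω) ^ 2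

end ZFE

end

/-!
The input is reconstructed exactly by `L G = 1`, so the error of the mechanism is the noise filtered
by `M = F L`. Its mean square value is the noise variance times `‖M‖₂²` (`hasMSE`), a Cesàro limit of
a nondecreasing sequence that may be infinite. The sensitivity of `G` is `k₁ ‖G‖₂`
(`sensitivity_eq`), whence the error is `k₁² κ² ‖M‖₂² ‖G‖₂²`, with `M G = F`. Integrals
below are for `dω / 2π`.

*Lower bound.* If `‖M‖₂` is finite, then `F(e^{jω}) = M(e^{jω}) G(e^{jω})` almost everywhere
(`freqLp_comp`), because both sides are integrable with the same Fourier coefficients. So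
`|F| ≤ |M| |G|`, and the Cauchy–Schwarz inequality gives `(∫ |F|)² ≤ ‖M‖₂² ‖G‖₂²`
(`sq_integral_le`).

*Attainment.* Under the Paley–Wiener condition, let `g = ½ ln |F|₂`, and let `G = exp (herglotz g)`
and `L = exp (-herglotz g)`, which have real coefficients as `g` is even. The key estimate
`tsum_conv_outerCoeff_le` says that `‖c exp (herglotz g)‖₂² ≤ ∫ |c|² exp (2 g)` for `c` in `H²` and any
integrable `g`. It is clear when `g` is the real part of a polynomial in `e^{-jω}`, and it passes to
the limit, first for bounded `g` and then for all `g`, because the Taylor coefficients depend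
continuously on `g` in `L¹`. It yields `‖G‖₂² ≤ ∫ |F|` and `‖F L‖₂² ≤ ∫ |F|² / |F| = ∫ |F|`. With
`(∫ |F|)² ≤ ‖F L‖₂² ‖G‖₂²`, all these are equalities, so the bound is attained. The equality case of
the Cauchy–Schwarz inequality gives `|G|² = |F|₂` almost everywhere (`energy_mul_energy_eq`), without
any theorem on the boundary limits of outer functions.
-/

namespace ZFE

open scoped ENNReal

/-! ### Fourier series of causal sequences -/

/-- The circle `ℝ / 2πℤ` of angular frequencies. -/
abbrev Freq : Type := AddCircle (2 * Real.pi)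

/-- The normalized Haar measure `dω / 2π` on the circle of frequencies. -/
noncomputable abbrev freqMeasure : Measure Freq := AddCircle.haarAddCircle

/-- The function `∑ t, c t * e^{-jωt}` in `L²` of the circle, meaningful when `c` is
square-summable. -/
noncomputable def hardyLp (c : ℕ → ℂ) : Lp ℂ 2 freqMeasure :=
  ∑' t : ℕ, c t • fourierLp 2 (-(t : ℤ))

theorem negCast_injective : Function.Injective (fun t : ℕ => -(t : ℤ)) := fun a b h => by
  simpa using h

theorem hasSum_hardyLp {c : ℕ → ℂ} (hc : Summable fun t => ‖c t‖ ^ 2) :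
    HasSum (fun t : ℕ => c t • (fourierLp 2 (-(t : ℤ)) : Lp ℂ 2 freqMeasure)) (hardyLp c) := by
  have ho := (orthonormal_fourier (T := 2 * Real.pi)).comp _ negCast_injective
  exact ((ho.orthogonalFamily.summable_iff_norm_sq_summable c).2 hc).hasSum

theorem hasSum_fourierCoeff_hardyLp {c : ℕ → ℂ} (hc : Summable fun t => ‖c t‖ ^ 2) (n : ℤ) :
    HasSum (fun t : ℕ => if n = -(t : ℤ) then c t else 0) (fourierCoeff (hardyLp c) n) := by
  rw [← fourierBasis_repr, HilbertBasis.repr_apply_apply, coe_fourierBasis]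
  have key := (hasSum_hardyLp hc).mapL (innerSL ℂ (fourierLp 2 n))
  suffices h : (fun t : ℕ => if n = -(t : ℤ) then c t else 0) = fun t : ℕ =>
      innerSL ℂ (fourierLp 2 n) (c t • (fourierLp 2 (-(t : ℤ)) : Lp ℂ 2 freqMeasure)) by
    rw [h]; exact key
  funext t
  have := (orthonormal_iff_ite.1 (orthonormal_fourier (T := 2 * Real.pi))) n (-(t : ℤ))
  rw [innerSL_apply_apply, inner_smul_right, this]
  simp

theorem fourierCoeff_hardyLp {c : ℕ → ℂ} (hc : Summable fun t => ‖c t‖ ^ 2) (t : ℕ) :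
    fourierCoeff (hardyLp c) (-(t : ℤ)) = c t := by
  refine (hasSum_fourierCoeff_hardyLp hc _).unique ?_
  convert hasSum_ite_eq t (c t) using 2 with s
  by_cases h : s = t
  · simp [h]
  · have h' : ¬ t = s := fun e => h e.symm
    simp [h, h']

theorem fourierCoeff_hardyLp_of_pos {c : ℕ → ℂ} (hc : Summable fun t => ‖c t‖ ^ 2) {n : ℤ}
    (hn : 0 < n) : fourierCoeff (hardyLp c) n = 0 := by
  refine (hasSum_fourierCoeff_hardyLp hc _).unique ?_
  convert hasSum_zero using 2 with s
  rw [if_neg (by omega)]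

theorem lintegral_enorm_sq_Lp (f : Lp ℂ 2 freqMeasure) :
    ∫⁻ x, ‖f x‖ₑ ^ 2 ∂freqMeasure = ENNReal.ofReal (∫ x, ‖f x‖ ^ 2 ∂freqMeasure) := by
  rw [ofReal_integral_eq_lintegral_ofReal]
  · refine lintegral_congr fun x => ?_
    rw [ENNReal.ofReal_pow (norm_nonneg _), ofReal_norm]
  · exact (memLp_two_iff_integrable_sq_norm (Lp.memLp f).1).1 (Lp.memLp f)
  · exact Eventually.of_forall fun x => by positivity

theorem tsum_enorm_fourierCoeff (f : Lp ℂ 2 freqMeasure) :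
    ∑' n : ℤ, ‖fourierCoeff f n‖ₑ ^ 2 = ∫⁻ x, ‖f x‖ₑ ^ 2 ∂freqMeasure := by
  rw [lintegral_enorm_sq_Lp, ← tsum_sq_fourierCoeff, ENNReal.ofReal_tsum_of_nonneg
    (fun _ => by positivity) (hasSum_sq_fourierCoeff f).summable]
  refine tsum_congr fun n => ?_
  rw [ENNReal.ofReal_pow (norm_nonneg _), ofReal_norm]

theorem lintegral_hardyLp {c : ℕ → ℂ} (hc : Summable fun t => ‖c t‖ ^ 2) :
    ∫⁻ x, ‖hardyLp c x‖ₑ ^ 2 ∂freqMeasure = ∑' t, ‖c t‖ₑ ^ 2 := by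
  rw [← tsum_enorm_fourierCoeff, ← negCast_injective.tsum_eq]
  · simp only [fourierCoeff_hardyLp hc]
  · intro n hn
    by_contra h
    refine hn ?_
    have : 0 < n := by
      by_contra h'
      exact h ⟨n.natAbs, by simp only; omega⟩
    simp [fourierCoeff_hardyLp_of_pos hc this]

/-- Bessel's inequality on the negative frequencies, without assuming `f ∈ L²`. -/
theorem tsum_enorm_fourierCoeff_le {f : Freq → ℂ} (hf : AEStronglyMeasurable f freqMeasure) :
    ∑' t : ℕ, ‖fourierCoeff f (-(t : ℤ))‖ₑ ^ 2 ≤ ∫⁻ x, ‖f x‖ₑ ^ 2 ∂freqMeasure := by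
  by_cases h : ∫⁻ x, ‖f x‖ₑ ^ 2 ∂freqMeasure = ⊤
  · rw [h]; exact le_top
  have hL : MemLp f 2 freqMeasure := by
    refine ⟨hf, ?_⟩
    rw [eLpNorm_lt_top_iff_lintegral_rpow_enorm_lt_top (by simp) (by simp)]
    simpa [lt_top_iff_ne_top] using h
  have h1 : ∀ n, fourierCoeff (hL.toLp f) n = fourierCoeff f n := fun n =>
    congrFun (fourierCoeff_congr_ae hL.coeFn_toLp) n
  calc ∑' t : ℕ, ‖fourierCoeff f (-(t : ℤ))‖ₑ ^ 2
      = ∑' t : ℕ, ‖fourierCoeff (hL.toLp f) (-(t : ℤ))‖ₑ ^ 2 := by simp only [h1]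
    _ ≤ ∑' n : ℤ, ‖fourierCoeff (hL.toLp f) n‖ₑ ^ 2 :=
        ENNReal.tsum_comp_le_tsum_of_injective negCast_injective _
    _ = ∫⁻ x, ‖hL.toLp f x‖ₑ ^ 2 ∂freqMeasure := tsum_enorm_fourierCoeff _
    _ = _ := by
        refine lintegral_congr_ae ?_
        filter_upwards [hL.coeFn_toLp] with x hx
        rw [hx]

/-- The Fourier coefficients of a product of two square-integrable functions are the convolution of
their Fourier coefficients. -/
theorem hasSum_fourierCoeff_mul (f g : Lp ℂ 2 freqMeasure) (m : ℤ) :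
    HasSum (fun i : ℤ => fourierCoeff g (m - i) * fourierCoeff f i)
      (fourierCoeff (fun x => f x * g x) m) := by
  have hy : MemLp (fun x => fourier m x * starRingEnd ℂ (g x)) 2 freqMeasure := by
    refine MemLp.mono (Lp.memLp g) ?_ ?_
    · exact (map_continuous (fourier m)).aestronglyMeasurable.mul
        (Complex.continuous_conj.comp_aestronglyMeasurable (Lp.memLp g).1)
    · exact Eventually.of_forall fun x => by simp [fourier_apply, Circle.norm_coe]
  have key := (fourierBasis (T := 2 * Real.pi)).hasSum_inner_mul_inner (hy.toLp _) f
  have e1 : ∀ i : ℤ, inner ℂ (hy.toLp _) (fourierBasis (T := 2 * Real.pi) i) =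
      fourierCoeff g (m - i) := fun i => by
    rw [L2.inner_def, coe_fourierBasis]
    refine integral_congr_ae ?_
    filter_upwards [hy.coeFn_toLp, coeFn_fourierLp (T := 2 * Real.pi) 2 i] with x h1 h2
    rw [h1, h2, RCLike.inner_apply', map_mul, Complex.conj_conj, ← fourier_neg, smul_eq_mul,
      show -(m - i) = -m + i by ring, fourier_add]
    ring
  have e2 : inner ℂ (hy.toLp _) f = fourierCoeff (fun x => f x * g x) m := by
    rw [L2.inner_def]
    refine integral_congr_ae ?_
    filter_upwards [hy.coeFn_toLp] with x h1
    rw [h1, RCLike.inner_apply', map_mul, Complex.conj_conj, ← fourier_neg, smul_eq_mul]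
    ring
  simpa only [e1, e2, ← HilbertBasis.repr_apply_apply, fourierBasis_repr] using key

/-- The convolution `∑_{s + r = n} c s * d r` of two causal sequences. -/
def conv (c d : ℕ → ℂ) (n : ℕ) : ℂ := ∑ x ∈ Finset.HasAntidiagonal.antidiagonal n, c x.1 * d x.2

theorem fourierCoeff_hardyLp_mul {c d : ℕ → ℂ} (hc : Summable fun t => ‖c t‖ ^ 2)
    (hd : Summable fun t => ‖d t‖ ^ 2) (n : ℕ) :
    fourierCoeff (fun x => hardyLp c x * hardyLp d x) (-(n : ℤ)) = conv c d n := by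
  refine (hasSum_fourierCoeff_mul (hardyLp c) (hardyLp d) _).unique ?_
  have h0 : ∀ i : ℤ, i ∉ (Finset.range (n + 1)).image (fun t : ℕ => -(t : ℤ)) →
      fourierCoeff (hardyLp d) (-(n : ℤ) - i) * fourierCoeff (hardyLp c) i = 0 := by
    intro i hi
    rcases lt_or_ge 0 i with h | h
    · rw [fourierCoeff_hardyLp_of_pos hc h, mul_zero]
    · rw [fourierCoeff_hardyLp_of_pos hd, zero_mul]
      by_contra h'
      refine hi (Finset.mem_image.2 ⟨i.natAbs, ?_, ?_⟩)
      · rw [Finset.mem_range]; omega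
      · omega
  suffices h : conv c d n = ∑ i ∈ (Finset.range (n + 1)).image (fun t : ℕ => -(t : ℤ)),
      fourierCoeff (hardyLp d) (-(n : ℤ) - i) * fourierCoeff (hardyLp c) i by
    rw [h]; exact hasSum_sum_of_ne_finset_zero h0
  rw [Finset.sum_image (fun a _ b _ h => negCast_injective h), conv,
    Finset.Nat.sum_antidiagonal_eq_sum_range_succ_mk]
  refine Finset.sum_congr rfl fun t ht => ?_
  have : -(n : ℤ) - -(t : ℤ) = -((n - t : ℕ) : ℤ) := by
    have := Finset.mem_range.1 ht
    omega
  rw [this, fourierCoeff_hardyLp hc, fourierCoeff_hardyLp hd, mul_comm]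

theorem fourierCoeff_hardyLp_mul_of_pos {c d : ℕ → ℂ} (hc : Summable fun t => ‖c t‖ ^ 2)
    (hd : Summable fun t => ‖d t‖ ^ 2) {n : ℤ} (hn : 0 < n) :
    fourierCoeff (fun x => hardyLp c x * hardyLp d x) n = 0 := by
  refine (hasSum_fourierCoeff_mul (hardyLp c) (hardyLp d) _).unique ?_
  convert hasSum_zero using 2 with i
  rcases lt_or_ge 0 i with h | h
  · rw [fourierCoeff_hardyLp_of_pos hc h, mul_zero]
  · rw [fourierCoeff_hardyLp_of_pos hd (by omega), zero_mul]

/-- A convolution has at most the energy of the product of the frequency responses. -/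
theorem tsum_conv_le {c d : ℕ → ℂ} (hc : Summable fun t => ‖c t‖ ^ 2)
    (hd : Summable fun t => ‖d t‖ ^ 2) :
    ∑' n, ‖conv c d n‖ₑ ^ 2 ≤ ∫⁻ x, ‖hardyLp c x * hardyLp d x‖ₑ ^ 2 ∂freqMeasure := by
  simp only [← fourierCoeff_hardyLp_mul hc hd]
  exact tsum_enorm_fourierCoeff_le ((Lp.memLp _).1.mul (Lp.memLp _).1)

/-! ### Trigonometric approximation and uniqueness of Fourier coefficients -/

/-- A bounded measurable function is an almost everywhere limit of continuous functions with the
same bound. -/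
theorem exists_seq_continuous_tendsto {g : Freq → ℝ} (hg : AEStronglyMeasurable g freqMeasure)
    {M : ℝ} (hM : ∀ x, |g x| ≤ M) :
    ∃ ψ : ℕ → C(Freq, ℝ), (∀ k x, |ψ k x| ≤ M) ∧
      ∀ᵐ x ∂freqMeasure, Tendsto (fun k => ψ k x) atTop (𝓝 (g x)) := by
  have hM0 : 0 ≤ M := (abs_nonneg _).trans (hM 0)
  have hgL : MemLp g 1 freqMeasure :=
    MemLp.of_bound hg M (Eventually.of_forall fun x => by simpa using hM x)
  have h1 : ∀ k : ℕ, ∃ φ : BoundedContinuousFunction Freq ℝ,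
      eLpNorm (g - (φ : Freq → ℝ)) 1 freqMeasure ≤ ((k : ℝ≥0∞) + 1)⁻¹ ∧ MemLp φ 1 freqMeasure := fun k =>
    hgL.exists_boundedContinuous_eLpNorm_sub_le (by simp) (by simp)
  choose φ hφ hφm using h1
  have h2 : TendstoInMeasure freqMeasure (fun k x => φ k x) atTop g := by
    refine tendstoInMeasure_of_tendsto_eLpNorm one_ne_zero (fun k => (hφm k).1) hg ?_
    refine tendsto_of_tendsto_of_tendsto_of_le_of_le tendsto_const_nhds
      (h := fun k : ℕ => ((k : ℝ≥0∞) + 1)⁻¹) ?_ (fun _ => zero_le) fun k => ?_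
    · have := (tendsto_add_atTop_iff_nat 1).2 ENNReal.tendsto_inv_nat_nhds_zero
      simpa using this
    · rw [← eLpNorm_neg, neg_sub]
      exact hφ k
  obtain ⟨ns, -, hns⟩ := h2.exists_seq_tendsto_ae
  -- clipping to `[-M, M]` restores the bound and fixes the limit
  refine ⟨fun k => ⟨fun x => max (-M) (min M (φ (ns k) x)), by fun_prop⟩, fun k x => ?_, ?_⟩
  · exact abs_le.2 ⟨le_max_left _ _, max_le (by linarith) (min_le_left _ _)⟩
  · filter_upwards [hns] with x hx
    have : g x = max (-M) (min M (g x)) := by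
      rw [min_eq_right (abs_le.1 (hM x)).2, max_eq_right (abs_le.1 (hM x)).1]
    rw [this]
    exact tendsto_const_nhds.max (tendsto_const_nhds.min hx)

theorem exists_fourier_span_near (ψ : C(Freq, ℂ)) {ε : ℝ} (hε : 0 < ε) :
    ∃ q ∈ Submodule.span ℂ (Set.range (fourier (T := 2 * Real.pi))), ∀ x, ‖ψ x - q x‖ < ε := by
  have h : ψ ∈ (Submodule.span ℂ (Set.range (fourier (T := 2 * Real.pi)))).topologicalClosure := by
    rw [span_fourier_closure_eq_top]; trivial
  obtain ⟨q, hq, hd⟩ := Metric.mem_closure_iff.1 h ε hε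
  refine ⟨q, hq, fun x => ?_⟩
  rw [← dist_eq_norm]
  exact (ContinuousMap.dist_apply_le_dist x).trans_lt hd

/-- The point `e^{-jω}` of the unit circle at the frequency `ω`. -/
noncomputable def unitPt (x : Freq) : ℂ := fourier (-1) x

theorem continuous_unitPt : Continuous unitPt := map_continuous (fourier (-1))

theorem unitPt_pow (x : Freq) (n : ℕ) : unitPt x ^ n = fourier (-(n : ℤ)) x := by
  induction n with
  | zero => simp
  | succ n ih =>
    rw [pow_succ, ih, unitPt, ← fourier_add]
    congr 2
    push_cast; ring

theorem conj_unitPt_pow (x : Freq) (n : ℕ) : starRingEnd ℂ (unitPt x) ^ n = fourier (n : ℤ) x := by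
  rw [← map_pow, unitPt_pow, ← fourier_neg, neg_neg]

/-- The real part of a trigonometric polynomial is that of a polynomial in `e^{-jω}`. The factor `c`
makes the induction go through scalar multiplication. -/
theorem exists_re_eval_eq {q : C(Freq, ℂ)}
    (hq : q ∈ Submodule.span ℂ (Set.range (fourier (T := 2 * Real.pi)))) :
    ∀ c : ℂ, ∃ p : Polynomial ℂ, ∀ x, (c * q x).re = (p.eval (unitPt x)).re := by
  induction hq using Submodule.span_induction with
  | mem q hq =>
    obtain ⟨n, rfl⟩ := hq
    intro c
    rcases le_total n 0 with h | h
    · refine ⟨Polynomial.C c * Polynomial.X ^ n.natAbs, fun x => ?_⟩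
      rw [Polynomial.eval_mul, Polynomial.eval_C, Polynomial.eval_pow, Polynomial.eval_X,
        unitPt_pow, show -(n.natAbs : ℤ) = n by omega]
    · refine ⟨Polynomial.C (starRingEnd ℂ c) * Polynomial.X ^ n.natAbs, fun x => ?_⟩
      rw [Polynomial.eval_mul, Polynomial.eval_C, Polynomial.eval_pow, Polynomial.eval_X,
        unitPt_pow, show -(n.natAbs : ℤ) = -n by omega, fourier_neg, ← map_mul, Complex.conj_re]
  | zero => exact fun c => ⟨0, fun x => by simp⟩
  | add q₁ q₂ _ _ h₁ h₂ =>
    intro c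
    obtain ⟨p₁, h₁⟩ := h₁ c
    obtain ⟨p₂, h₂⟩ := h₂ c
    refine ⟨p₁ + p₂, fun x => ?_⟩
    rw [Polynomial.eval_add, Complex.add_re, ← h₁, ← h₂, ← Complex.add_re, ← mul_add]
    rfl
  | smul a q _ h =>
    intro c
    obtain ⟨p, h⟩ := h (c * a)
    refine ⟨p, fun x => ?_⟩
    rw [← h, mul_assoc]
    rfl

/-- A bounded measurable function is a bounded almost everywhere limit of real parts of polynomials
in `e^{-jω}`. -/
theorem exists_seq_polynomial_tendsto {g : Freq → ℝ} (hg : AEStronglyMeasurable g freqMeasure)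
    {M : ℝ} (hM : ∀ x, |g x| ≤ M) :
    ∃ p : ℕ → Polynomial ℂ, (∀ k x, |((p k).eval (unitPt x)).re| ≤ M + 1) ∧
      ∀ᵐ x ∂freqMeasure, Tendsto (fun k => ((p k).eval (unitPt x)).re) atTop (𝓝 (g x)) := by
  obtain ⟨ψ, hψ, hlim⟩ := exists_seq_continuous_tendsto hg hM
  have h1 : ∀ k : ℕ, ∃ p : Polynomial ℂ, ∀ x, |ψ k x - (p.eval (unitPt x)).re| < 1 / (k + 1) := by
    intro k
    obtain ⟨q, hq, hd⟩ := exists_fourier_span_near (ψ := ⟨fun x => (ψ k x : ℂ), by fun_prop⟩)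
      (ε := 1 / ((k : ℝ) + 1)) (by positivity)
    obtain ⟨p, hp⟩ := exists_re_eval_eq hq 1
    refine ⟨p, fun x => ?_⟩
    refine lt_of_le_of_lt ?_ (hd x)
    rw [← hp, one_mul]
    simpa using Complex.abs_re_le_norm ((ψ k x : ℂ) - q x)
  choose p hp using h1
  refine ⟨p, fun k x => ?_, ?_⟩
  · have h2 : (1 : ℝ) / (k + 1) ≤ 1 := by
      rw [div_le_one (by positivity)]; linarith [k.cast_nonneg (α := ℝ)]
    have := abs_lt.1 (hp k x)
    have := abs_le.1 (hψ k x)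
    exact abs_le.2 ⟨by linarith, by linarith⟩
  · filter_upwards [hlim] with x hx
    have h0 : Tendsto (fun k => ψ k x - ((p k).eval (unitPt x)).re) atTop (𝓝 0) :=
      squeeze_zero_norm (fun k => by simpa using (hp k x).le) tendsto_one_div_add_atTop_nhds_zero_nat
    simpa using hx.sub h0

/-- An integrable function on the circle is determined by its Fourier coefficients. -/
theorem ae_eq_zero_of_fourierCoeff_eq_zero {f : Freq → ℂ} (hf : Integrable f freqMeasure)
    (h : ∀ n, fourierCoeff f n = 0) : f =ᵐ[freqMeasure] 0 := by
  have hb : ∀ q : C(Freq, ℂ), Integrable (fun x => q x * f x) freqMeasure := fun q =>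
    hf.bdd_mul (c := ‖q‖) (map_continuous q).aestronglyMeasurable
      (Eventually.of_forall fun x => q.norm_coe_le_norm x)
  -- `∫ q f = 0` for trigonometric polynomials, then for continuous functions, then for indicators
  have hspan : ∀ q ∈ Submodule.span ℂ (Set.range (fourier (T := 2 * Real.pi))),
      ∫ x, q x * f x ∂freqMeasure = 0 := by
    intro q hq
    induction hq using Submodule.span_induction with
    | mem q hq =>
      obtain ⟨n, rfl⟩ := hq
      have := h (-n)
      rwa [fourierCoeff, neg_neg] at this
    | zero => simp
    | add q₁ q₂ _ _ h₁ h₂ =>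
      simp only [ContinuousMap.add_apply, add_mul]
      rw [integral_add (hb _) (hb _), h₁, h₂, add_zero]
    | smul a q _ h =>
      simp only [ContinuousMap.smul_apply, smul_eq_mul, mul_assoc]
      rw [integral_const_mul, h, mul_zero]
  have hcont : ∀ ψ : C(Freq, ℂ), ∫ x, ψ x * f x ∂freqMeasure = 0 := by
    intro ψ
    by_contra hne
    have hI : 0 ≤ ∫ x, ‖f x‖ ∂freqMeasure := integral_nonneg fun x => norm_nonneg _
    have hpos : 0 < ‖∫ x, ψ x * f x ∂freqMeasure‖ := norm_pos_iff.2 hne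
    obtain ⟨q, hq, hd⟩ := exists_fourier_span_near ψ
      (ε := ‖∫ x, ψ x * f x ∂freqMeasure‖ / (1 + ∫ x, ‖f x‖ ∂freqMeasure)) (by positivity)
    have h1 : ∫ x, ψ x * f x ∂freqMeasure = ∫ x, (ψ x - q x) * f x ∂freqMeasure := by
      simp only [sub_mul]
      rw [integral_sub (hb _) (hb _), hspan q hq, sub_zero]
    have h2 : ‖∫ x, ψ x * f x ∂freqMeasure‖ ≤
        ‖∫ x, ψ x * f x ∂freqMeasure‖ / (1 + ∫ x, ‖f x‖ ∂freqMeasure) *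
          ∫ x, ‖f x‖ ∂freqMeasure := by
      conv_lhs => rw [h1]
      rw [← integral_const_mul]
      refine norm_integral_le_of_norm_le (hf.norm.const_mul _) (Eventually.of_forall fun x => ?_)
      rw [norm_mul]
      exact mul_le_mul_of_nonneg_right (hd x).le (norm_nonneg _)
    rw [div_mul_eq_mul_div, le_div_iff₀ (by positivity)] at h2
    nlinarith
  refine hf.ae_eq_zero_of_forall_setIntegral_eq_zero fun s hs _ => ?_
  have hbd : ∀ x, |s.indicator (fun _ => (1 : ℝ)) x| ≤ 1 := fun x => by
    by_cases hx : x ∈ s <;> simp [hx]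
  obtain ⟨ψ, hψ, hlim⟩ := exists_seq_continuous_tendsto
    ((stronglyMeasurable_one.indicator hs).aestronglyMeasurable (f := s.indicator fun _ => (1 : ℝ)))
    hbd
  have h1 : Tendsto (fun k => ∫ x, (ψ k x : ℂ) * f x ∂freqMeasure) atTop
      (𝓝 (∫ x, ((s.indicator (fun _ => (1 : ℝ)) x : ℝ) : ℂ) * f x ∂freqMeasure)) := by
    refine tendsto_integral_of_dominated_convergence (fun x => ‖f x‖) (fun k => ?_) hf.norm
      (fun k => Eventually.of_forall fun x => ?_) ?_
    · exact (by fun_prop : Continuous fun x => (ψ k x : ℂ)).aestronglyMeasurable.mul hf.1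
    · rw [norm_mul, Complex.norm_real]
      exact mul_le_of_le_one_left (norm_nonneg _) (hψ k x)
    · filter_upwards [hlim] with x hx
      exact ((Complex.continuous_ofReal.tendsto _).comp hx).mul_const _
  have h2 : ∀ k, ∫ x, (ψ k x : ℂ) * f x ∂freqMeasure = 0 := fun k =>
    hcont ⟨fun x => (ψ k x : ℂ), by fun_prop⟩
  simp only [h2] at h1
  rw [← integral_indicator hs, ← tendsto_nhds_unique h1 tendsto_const_nhds]
  refine integral_congr_ae (Eventually.of_forall fun x => ?_)
  by_cases hx : x ∈ s <;> simp [hx]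

theorem integrable_Lp_mul (f g : Lp ℂ 2 freqMeasure) :
    Integrable (fun x => f x * g x) freqMeasure :=
  (Lp.memLp f).integrable_mul (Lp.memLp g)

theorem integrable_Lp (f : Lp ℂ 2 freqMeasure) : Integrable f freqMeasure :=
  (Lp.memLp f).integrable (by norm_num)

/-! ### Outer functions -/

/-- The Herglotz integral `(1 / 2π) ∫ (1 + ζ e^{jω}) / (1 - ζ e^{jω}) g(ω) dω` of `g`. In the variable
`z = 1 / ζ`, its kernel is `(z + e^{jω}) / (z - e^{jω})`. Only its values on `|ζ| < 1` matter. -/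
noncomputable def herglotz (g : Freq → ℝ) (ζ : ℂ) : ℂ :=
  ∫ x, (1 + ζ * fourier 1 x) / (1 - ζ * fourier 1 x) * (g x : ℂ) ∂freqMeasure

theorem norm_fourier_apply (n : ℤ) (x : Freq) : ‖fourier n x‖ = 1 := by
  simp [fourier_apply, Circle.norm_coe]

theorem norm_mul_fourier (ζ : ℂ) (n : ℤ) (x : Freq) : ‖ζ * fourier n x‖ = ‖ζ‖ := by
  rw [norm_mul, norm_fourier_apply, mul_one]

theorem one_sub_mul_fourier_ne_zero {ζ : ℂ} (hζ : ‖ζ‖ < 1) (x : Freq) :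
    1 - ζ * fourier 1 x ≠ 0 := by
  intro h
  have := norm_mul_fourier ζ 1 x
  rw [← sub_eq_zero.1 h, norm_one] at this
  linarith

theorem continuous_herglotz_kernel {ζ : ℂ} (hζ : ‖ζ‖ < 1) :
    Continuous fun x : Freq => (1 + ζ * fourier 1 x) / (1 - ζ * fourier 1 x) := by
  have := map_continuous (fourier (T := 2 * Real.pi) 1)
  exact (by fun_prop : Continuous fun x : Freq => 1 + ζ * fourier 1 x).div
    (by fun_prop) (one_sub_mul_fourier_ne_zero hζ)

theorem norm_herglotz_kernel_le {ζ : ℂ} {r : ℝ} (hr : r < 1) (hζ : ‖ζ‖ ≤ r) (x : Freq) :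
    ‖(1 + ζ * fourier 1 x) / (1 - ζ * fourier 1 x)‖ ≤ 2 / (1 - r) := by
  have h1 : ‖1 + ζ * fourier 1 x‖ ≤ 2 := by
    refine (norm_add_le _ _).trans ?_
    rw [norm_mul_fourier, norm_one]; linarith
  have h2 : 1 - r ≤ ‖1 - ζ * fourier 1 x‖ := by
    have := norm_sub_norm_le 1 (ζ * fourier 1 x)
    rw [norm_mul_fourier, norm_one] at this
    linarith
  rw [norm_div]
  exact div_le_div₀ (by norm_num) h1 (by linarith) h2

theorem integrable_ofReal {g : Freq → ℝ} (hg : Integrable g freqMeasure) :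
    Integrable (fun x => (g x : ℂ)) freqMeasure := hg.ofReal

theorem integrable_herglotz {g : Freq → ℝ} (hg : Integrable g freqMeasure) {ζ : ℂ} (hζ : ‖ζ‖ < 1) :
    Integrable (fun x => (1 + ζ * fourier 1 x) / (1 - ζ * fourier 1 x) * (g x : ℂ)) freqMeasure :=
  hg.ofReal.bdd_mul (continuous_herglotz_kernel hζ).aestronglyMeasurable
    (Eventually.of_forall (norm_herglotz_kernel_le hζ le_rfl))

theorem norm_herglotz_sub_le {g g' : Freq → ℝ} (hg : Integrable g freqMeasure)
    (hg' : Integrable g' freqMeasure) {ζ : ℂ} {r : ℝ} (hr : r < 1) (hζ : ‖ζ‖ ≤ r) :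
    ‖herglotz g ζ - herglotz g' ζ‖ ≤ 2 / (1 - r) * ∫ x, |g x - g' x| ∂freqMeasure := by
  have hζ1 := hζ.trans_lt hr
  rw [herglotz, herglotz, ← integral_sub (integrable_herglotz hg hζ1) (integrable_herglotz hg' hζ1),
    ← integral_const_mul]
  refine norm_integral_le_of_norm_le ((hg.sub hg').norm.const_mul _)
    (Eventually.of_forall fun x => ?_)
  rw [← mul_sub, norm_mul, ← Complex.ofReal_sub, Complex.norm_real]
  exact mul_le_mul_of_nonneg_right (norm_herglotz_kernel_le hr hζ x) (norm_nonneg _)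

theorem norm_herglotz_le {g : Freq → ℝ} (hg : Integrable g freqMeasure) {ζ : ℂ} {r : ℝ} (hr : r < 1)
    (hζ : ‖ζ‖ ≤ r) : ‖herglotz g ζ‖ ≤ 2 / (1 - r) * ∫ x, |g x| ∂freqMeasure := by
  have h0 : herglotz 0 ζ = 0 := by simp [herglotz]
  simpa [h0] using norm_herglotz_sub_le hg (integrable_zero _ _ _) hr hζ

theorem herglotz_neg (g : Freq → ℝ) (ζ : ℂ) : herglotz (-g) ζ = -herglotz g ζ := by
  simp [herglotz, integral_neg]

theorem integrable_fourier_mul {g : Freq → ℝ} (hg : Integrable g freqMeasure) (n : ℤ) :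
    Integrable (fun x => fourier n x * (g x : ℂ)) freqMeasure :=
  hg.ofReal.bdd_mul (map_continuous (fourier n)).aestronglyMeasurable
    (Eventually.of_forall fun x => (norm_fourier_apply n x).le)

theorem fourier_one_pow (x : Freq) (n : ℕ) : fourier 1 x ^ n = fourier (n : ℤ) x := by
  rw [← conj_unitPt_pow, unitPt, ← fourier_neg, neg_neg]

/-- The power series of the Herglotz integral: its coefficients are Fourier coefficients of `g`. -/
theorem hasSum_herglotz {g : Freq → ℝ} (hg : Integrable g freqMeasure) {ζ : ℂ} (hζ : ‖ζ‖ < 1) :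
    HasSum (fun n : ℕ => ζ ^ n * ∫ x, fourier (n : ℤ) x * (g x : ℂ) ∂freqMeasure)
      ((herglotz g ζ + ∫ x, (g x : ℂ) ∂freqMeasure) / 2) := by
  have h1 : ∀ x, HasSum (fun n : ℕ => ζ ^ n * (fourier (n : ℤ) x * (g x : ℂ)))
      (((1 + ζ * fourier 1 x) / (1 - ζ * fourier 1 x) * (g x : ℂ) + g x) / 2) := fun x => by
    have := (hasSum_geometric_of_norm_lt_one
      ((norm_mul_fourier ζ 1 x).trans_lt hζ)).mul_right (g x : ℂ)
    have e : (((1 + ζ * fourier 1 x) / (1 - ζ * fourier 1 x) * (g x : ℂ) + g x) / 2) =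
        (1 - ζ * fourier 1 x)⁻¹ * g x := by
      have := one_sub_mul_fourier_ne_zero hζ x
      field_simp
      ring
    rw [e]
    simpa only [mul_pow, mul_assoc, fourier_one_pow] using this
  have h2 := hasSum_integral_of_summable_integral_norm
    (F := fun (n : ℕ) x => ζ ^ n * (fourier (n : ℤ) x * (g x : ℂ))) (μ := freqMeasure)
    (fun n => (integrable_fourier_mul hg n).const_mul _) (by
      have : ∀ n : ℕ, ∫ x, ‖ζ ^ n * (fourier (n : ℤ) x * (g x : ℂ))‖ ∂freqMeasure =
          ‖ζ‖ ^ n * ∫ x, |g x| ∂freqMeasure := fun n => by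
        rw [← integral_const_mul]
        refine integral_congr_ae (Eventually.of_forall fun x => ?_)
        simp only [norm_mul, norm_pow, norm_fourier_apply, one_mul, Complex.norm_real,
          Real.norm_eq_abs]
      simp only [this]
      exact (summable_geometric_of_lt_one (norm_nonneg _) hζ).mul_right _)
  have h3 : ∫ x, ∑' n : ℕ, ζ ^ n * (fourier (n : ℤ) x * (g x : ℂ)) ∂freqMeasure =
      (herglotz g ζ + ∫ x, (g x : ℂ) ∂freqMeasure) / 2 := by
    rw [herglotz, ← integral_add (integrable_herglotz hg hζ) (integrable_ofReal hg), ← integral_div]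
    exact integral_congr_ae (Eventually.of_forall fun x => (h1 x).tsum_eq)
  rw [h3] at h2
  simpa only [integral_const_mul] using h2

theorem differentiableOn_herglotz {g : Freq → ℝ} (hg : Integrable g freqMeasure) :
    DifferentiableOn ℂ (herglotz g) (Metric.ball 0 1) := by
  intro ζ hζ
  rw [mem_ball_zero_iff] at hζ
  obtain ⟨r, hr, hr1⟩ := exists_between hζ
  have hr0 : 0 ≤ r := (norm_nonneg ζ).trans hr.le
  have hd : DifferentiableOn ℂ
      (fun w => ∑' n : ℕ, w ^ n * ∫ x, fourier (n : ℤ) x * (g x : ℂ) ∂freqMeasure)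
      (Metric.ball 0 r) := by
    refine Complex.differentiableOn_tsum_of_summable_norm
      (u := fun n => r ^ n * ∫ x, |g x| ∂freqMeasure)
      ((summable_geometric_of_lt_one hr0 hr1).mul_right _)
      (fun n => by fun_prop) Metric.isOpen_ball fun n w hw => ?_
    rw [mem_ball_zero_iff] at hw
    rw [norm_mul, norm_pow]
    refine mul_le_mul (pow_le_pow_left₀ (norm_nonneg _) hw.le n) ?_ (norm_nonneg _) (by positivity)
    refine norm_integral_le_of_norm_le hg.norm (Eventually.of_forall fun x => ?_)
    rw [norm_mul, norm_fourier_apply, one_mul, Complex.norm_real, Real.norm_eq_abs]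
  have hat : DifferentiableAt ℂ (fun w =>
      2 * (∑' n : ℕ, w ^ n * ∫ x, fourier (n : ℤ) x * (g x : ℂ) ∂freqMeasure) -
        ∫ x, (g x : ℂ) ∂freqMeasure) ζ :=
    ((hd.differentiableAt (Metric.isOpen_ball.mem_nhds (by simpa using hr))).const_mul 2).sub_const _
  refine (hat.congr_of_eventuallyEq ?_).differentiableWithinAt
  filter_upwards [Metric.isOpen_ball.mem_nhds (by simpa using hζ : ζ ∈ Metric.ball (0 : ℂ) 1)]
    with w hw
  rw [(hasSum_herglotz hg (by simpa using hw)).tsum_eq]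
  ring

/-- The outer function `exp (herglotz g)`, of boundary modulus `exp g`. -/
noncomputable def outerFn (g : Freq → ℝ) (ζ : ℂ) : ℂ := Complex.exp (herglotz g ζ)

/-- The Taylor coefficients at `0` of the outer function `exp (herglotz g)`. -/
noncomputable def outerCoeff (g : Freq → ℝ) (n : ℕ) : ℂ :=
  (n.factorial : ℂ)⁻¹ * iteratedDeriv n (outerFn g) 0

theorem differentiableOn_outerFn {g : Freq → ℝ} (hg : Integrable g freqMeasure) :
    DifferentiableOn ℂ (outerFn g) (Metric.ball 0 1) :=
  (differentiableOn_herglotz hg).cexp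

theorem hasSum_outerCoeff {g : Freq → ℝ} (hg : Integrable g freqMeasure) {ζ : ℂ} (hζ : ‖ζ‖ < 1) :
    HasSum (fun n => outerCoeff g n * ζ ^ n) (outerFn g ζ) := by
  have := Complex.hasSum_taylorSeries_on_ball (differentiableOn_outerFn hg)
    (by simpa using hζ : ζ ∈ Metric.ball (0 : ℂ) 1)
  simp only [sub_zero, smul_eq_mul] at this
  convert! this using 2 with n
  rw [outerCoeff]; ring

theorem contDiffAt_outerFn {g : Freq → ℝ} (hg : Integrable g freqMeasure) (n : ℕ) :
    ContDiffAt ℂ n (outerFn g) 0 :=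
  ((differentiableOn_outerFn hg).analyticAt (Metric.isOpen_ball.mem_nhds (by simp))).contDiffAt

/-- The outer functions of `g` and of `-g` are inverse to each other. -/
theorem conv_outerCoeff_neg {g : Freq → ℝ} (hg : Integrable g freqMeasure) (n : ℕ) :
    conv (outerCoeff (-g)) (outerCoeff g) n = if n = 0 then 1 else 0 := by
  have h1 : outerFn (-g) * outerFn g = fun _ => 1 := by
    funext ζ
    rw [Pi.mul_apply, outerFn, outerFn, herglotz_neg, ← Complex.exp_add, neg_add_cancel,
      Complex.exp_zero]
  have h2 := iteratedDeriv_mul (contDiffAt_outerFn hg.neg n) (contDiffAt_outerFn hg n)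
  rw [h1, iteratedDeriv_const] at h2
  rw [conv, Finset.Nat.sum_antidiagonal_eq_sum_range_succ_mk]
  have h3 : ∀ i ∈ Finset.range n.succ, outerCoeff (-g) i * outerCoeff g (n - i) =
      (n.factorial : ℂ)⁻¹ * (n.choose i * iteratedDeriv i (outerFn (-g)) 0 *
        iteratedDeriv (n - i) (outerFn g) 0) := by
    intro i hi
    have hi' : i ≤ n := Nat.lt_succ_iff.1 (Finset.mem_range.1 hi)
    have hc : (n.choose i : ℂ) * (i.factorial * (n - i).factorial) = n.factorial := by
      rw [← mul_assoc]; exact_mod_cast Nat.choose_mul_factorial_mul_factorial hi'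
    have h4 : ((i.factorial : ℂ)) ≠ 0 := by exact_mod_cast i.factorial_ne_zero
    have h5 : (((n - i).factorial : ℂ)) ≠ 0 := by exact_mod_cast (n - i).factorial_ne_zero
    have h6 : (n.choose i : ℂ) ≠ 0 := by exact_mod_cast (Nat.choose_pos hi').ne'
    rw [outerCoeff, outerCoeff, ← hc]
    field_simp
  rw [Finset.sum_congr rfl h3, ← Finset.mul_sum, ← h2]
  by_cases hn : n = 0 <;> simp [hn]

theorem tendsto_iteratedDeriv {F : ℕ → ℂ → ℂ} {f : ℂ → ℂ} {U : Set ℂ} (hU : IsOpen U) (n : ℕ)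
    (h : TendstoLocallyUniformlyOn F f atTop U) (hF : ∀ k, DifferentiableOn ℂ (F k) U)
    {z : ℂ} (hz : z ∈ U) :
    Tendsto (fun k => iteratedDeriv n (F k) z) atTop (𝓝 (iteratedDeriv n f z)) := by
  induction n generalizing F f with
  | zero => simpa using h.tendsto_at hz
  | succ n ih =>
    simp only [iteratedDeriv_succ']
    exact ih (h.deriv (Eventually.of_forall hF) hU) fun k => (hF k).deriv hU

/-- The coefficients of the outer function depend continuously on `g ∈ L¹`. -/
theorem tendsto_outerCoeff {g : ℕ → Freq → ℝ} {g' : Freq → ℝ}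
    (hg : ∀ k, Integrable (g k) freqMeasure) (hg' : Integrable g' freqMeasure)
    (h : Tendsto (fun k => ∫ x, |g k x - g' x| ∂freqMeasure) atTop (𝓝 0)) (n : ℕ) :
    Tendsto (fun k => outerCoeff (g k) n) atTop (𝓝 (outerCoeff g' n)) := by
  refine Tendsto.const_mul _ ?_
  -- on `|ζ| < 1 / 2` the kernel is bounded by `4`
  have hsub : Metric.ball (0 : ℂ) (1 / 2) ⊆ Metric.ball 0 1 := Metric.ball_subset_ball (by norm_num)
  refine tendsto_iteratedDeriv (U := Metric.ball 0 (1 / 2)) Metric.isOpen_ball n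
    (TendstoUniformlyOn.tendstoLocallyUniformlyOn ?_)
    (fun k => (differentiableOn_outerFn (hg k)).mono hsub) (by simp)
  refine TendstoUniformlyOn.comp_cexp (f := fun k => herglotz (g k)) ?_ ?_
  · rw [Metric.tendstoUniformlyOn_iff]
    intro ε hε
    filter_upwards [h.eventually (gt_mem_nhds (show 0 < ε / 4 by positivity))] with k hk ζ hζ
    rw [dist_comm, dist_eq_norm]
    refine (norm_herglotz_sub_le (hg k) hg' (r := 1 / 2) (by norm_num) ?_).trans_lt ?_
    · simpa using (mem_ball_zero_iff.1 hζ).le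
    · norm_num; linarith
  · refine ⟨2 / (1 - 1 / 2) * ∫ x, |g' x| ∂freqMeasure, ?_⟩
    rintro _ ⟨ζ, hζ, rfl⟩
    exact (Complex.re_le_norm _).trans
      (norm_herglotz_le hg' (by norm_num) (mem_ball_zero_iff.1 hζ).le)

theorem herglotz_conj {g : Freq → ℝ} (hg : ∀ᵐ x ∂freqMeasure, g (-x) = g x) (ζ : ℂ) :
    starRingEnd ℂ (herglotz g (starRingEnd ℂ ζ)) = herglotz g ζ := by
  rw [herglotz, ← integral_conj, herglotz, ← integral_neg_eq_self]
  refine integral_congr_ae ?_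
  filter_upwards [hg] with x hx
  have : starRingEnd ℂ (fourier 1 (-x)) = fourier 1 x := by
    rw [← fourier_neg, fourier_apply, fourier_apply]
    simp
  simp only [map_mul, map_div₀, map_add, map_sub, map_one, Complex.conj_conj, Complex.conj_ofReal,
    this, hx]

theorem iteratedDeriv_conj_conj (f : ℂ → ℂ) (n : ℕ) :
    iteratedDeriv n (starRingEnd ℂ ∘ f ∘ starRingEnd ℂ) =
      starRingEnd ℂ ∘ iteratedDeriv n f ∘ starRingEnd ℂ := by
  induction n with
  | zero => simp
  | succ n ih => rw [iteratedDeriv_succ, ih, deriv_conj_conj, iteratedDeriv_succ]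

/-- The outer function of an even function has real coefficients. -/
theorem conj_outerCoeff {g : Freq → ℝ} (hg : ∀ᵐ x ∂freqMeasure, g (-x) = g x) (n : ℕ) :
    starRingEnd ℂ (outerCoeff g n) = outerCoeff g n := by
  have h1 : starRingEnd ℂ ∘ outerFn g ∘ starRingEnd ℂ = outerFn g := by
    funext ζ
    simp only [Function.comp_apply, outerFn, ← Complex.exp_conj, herglotz_conj hg]
  have h2 := congrFun (iteratedDeriv_conj_conj (outerFn g) n) 0
  rw [h1] at h2
  simp only [Function.comp_apply, map_zero] at h2
  rw [outerCoeff, map_mul, ← h2]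
  simp

theorem integral_fourier (n : ℤ) :
    ∫ x : Freq, fourier n x ∂freqMeasure = if n = 0 then 1 else 0 := by
  have := (orthonormal_iff_ite.1 (orthonormal_fourier (T := 2 * Real.pi))) 0 n
  rw [ContinuousMap.inner_toLp] at this
  simpa [eq_comm] using this

/-- Schwarz's formula: the Herglotz integral recovers a polynomial from its real part on the unit
circle, up to an imaginary constant. -/
theorem herglotz_re_eval (p : Polynomial ℂ) {ζ : ℂ} (hζ : ‖ζ‖ < 1) :
    herglotz (fun x => (p.eval (unitPt x)).re) ζ = p.eval ζ - (p.eval 0).im * Complex.I := by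
  have hint : ∀ p : Polynomial ℂ, Integrable (fun x => (p.eval (unitPt x)).re) freqMeasure :=
    fun p => by
      have := continuous_unitPt
      exact (Complex.continuous_re.comp (p.continuous.comp this)).integrable_of_hasCompactSupport
        (HasCompactSupport.of_compactSpace _)
  induction p using Polynomial.induction_on' with
  | add p q hp hq =>
    have : herglotz (fun x => ((p + q).eval (unitPt x)).re) ζ =
        herglotz (fun x => (p.eval (unitPt x)).re) ζ +
          herglotz (fun x => (q.eval (unitPt x)).re) ζ := by
      rw [herglotz, herglotz, herglotz, ← integral_add (integrable_herglotz (hint p) hζ)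
        (integrable_herglotz (hint q) hζ)]
      simp only [Polynomial.eval_add, Complex.add_re, Complex.ofReal_add, mul_add]
    rw [this, hp, hq, Polynomial.eval_add, Polynomial.eval_add, Complex.add_im]
    push_cast; ring
  | monomial k b =>
    have h1 : ∀ n : ℕ, ∫ x, fourier (n : ℤ) x * (((Polynomial.monomial k b).eval (unitPt x)).re : ℂ)
        ∂freqMeasure = b / 2 * (if n = k then 1 else 0) +
          starRingEnd ℂ b / 2 * (if n + k = 0 then 1 else 0) := by
      intro n
      have h2 : ∀ x : Freq, fourier (n : ℤ) x * (((Polynomial.monomial k b).eval (unitPt x)).re : ℂ)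
          = b / 2 * fourier ((n : ℤ) - k) x + starRingEnd ℂ b / 2 * fourier ((n : ℤ) + k) x := by
        intro x
        rw [Polynomial.eval_monomial, Complex.re_eq_add_conj, map_mul, map_pow, conj_unitPt_pow,
          unitPt_pow, sub_eq_add_neg, fourier_add, fourier_add]
        ring
      simp only [h2]
      have h3 : ∀ m : ℤ, Integrable (fun x : Freq => fourier m x) freqMeasure := fun m =>
        (map_continuous (fourier m)).integrable_of_hasCompactSupport
          (HasCompactSupport.of_compactSpace _)
      rw [integral_add ((h3 _).const_mul _) ((h3 _).const_mul _), integral_const_mul,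
        integral_const_mul, integral_fourier, integral_fourier]
      congr 3
      · simp only [sub_eq_zero, Nat.cast_inj]
      · simp only [← Nat.cast_add, Nat.cast_eq_zero]
    have h4 := hasSum_herglotz (hint (Polynomial.monomial k b)) hζ
    have h5 := h4.unique (hasSum_single k fun n hn => by
      rw [h1, if_neg hn, if_neg (by omega)]; simp)
    have h6 := h1 0
    have h7 := h1 k
    rw [Nat.cast_zero] at h6
    simp only [fourier_zero, one_mul] at h6
    rw [h7, h6] at h5
    rcases Nat.eq_zero_or_pos k with rfl | hk
    · have h8 := Complex.re_add_im b
      have h9 := Complex.sub_conj b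
      push_cast at h9
      simp at h5 ⊢
      linear_combination 2 * h5 - h9 / 2
    · simp [hk.ne', hk.ne] at h5 ⊢
      linear_combination 2 * h5

/-! ### Energy of a cascade with an outer function -/

theorem continuous_re_eval (p : Polynomial ℂ) : Continuous fun x => (p.eval (unitPt x)).re := by
  have := continuous_unitPt
  exact Complex.continuous_re.comp (p.continuous.comp this)

theorem integrable_re_eval (p : Polynomial ℂ) :
    Integrable (fun x => (p.eval (unitPt x)).re) freqMeasure :=
  (continuous_re_eval p).integrable_of_hasCompactSupport (HasCompactSupport.of_compactSpace _)

/-- When `g` is the real part of a polynomial on the unit circle, the outer function is the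
exponential of a polynomial, so its Taylor series converges everywhere. -/
theorem hasSum_outerCoeff_re_eval (p : Polynomial ℂ) (ζ : ℂ) :
    HasSum (fun n => outerCoeff (fun x => (p.eval (unitPt x)).re) n * ζ ^ n)
      (Complex.exp (p.eval ζ - (p.eval 0).im * Complex.I)) := by
  have hd : Differentiable ℂ fun ζ => Complex.exp (p.eval ζ - (p.eval 0).im * Complex.I) :=
    (p.differentiable.sub_const _).cexp
  have h := Complex.hasSum_taylorSeries_of_entire hd 0 ζ
  have he : outerFn (fun x => (p.eval (unitPt x)).re) =ᶠ[𝓝 0]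
      fun ζ => Complex.exp (p.eval ζ - (p.eval 0).im * Complex.I) := by
    filter_upwards [Metric.isOpen_ball.mem_nhds (by simp : (0 : ℂ) ∈ Metric.ball (0 : ℂ) 1)]
      with w hw
    rw [outerFn, herglotz_re_eval p (by simpa using hw)]
  simp only [sub_zero, smul_eq_mul] at h
  convert! h using 2 with n
  rw [outerCoeff, he.iteratedDeriv_eq]; ring

theorem summable_outerCoeff_re_eval (p : Polynomial ℂ) :
    Summable fun n => ‖outerCoeff (fun x => (p.eval (unitPt x)).re) n‖ := by
  have := (hasSum_outerCoeff_re_eval p 1).summable.norm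
  simpa using this

theorem summable_norm_sq {c : ℕ → ℂ} (hc : Summable fun n => ‖c n‖) :
    Summable fun n => ‖c n‖ ^ 2 := by
  have h := hc.mul_of_nonneg hc (fun _ => norm_nonneg _) (fun _ => norm_nonneg _)
  have h2 := h.comp_injective (i := fun n : ℕ => (n, n)) fun a b h => (Prod.ext_iff.1 h).1
  simpa only [Function.comp_def, ← sq] using h2

theorem hardyLp_eq_of_hasSum {c : ℕ → ℂ} (hc : Summable fun n => ‖c n‖) {Φ : Freq → ℂ}
    (hΦ : ∀ x, HasSum (fun n => c n * unitPt x ^ n) (Φ x)) : hardyLp c =ᵐ[freqMeasure] Φ := by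
  have h1 : Summable fun n : ℕ => c n • fourier (T := 2 * Real.pi) (-(n : ℤ)) := by
    refine Summable.of_norm ?_
    simpa only [norm_smul, fourier_norm, mul_one] using hc
  obtain ⟨S, hS⟩ := h1
  have h2 : ∀ x, S x = Φ x := fun x => by
    refine HasSum.unique ?_ (hΦ x)
    have := hS.mapL (ContinuousMap.evalCLM ℂ x)
    simpa only [ContinuousMap.evalCLM_apply, ContinuousMap.smul_apply, smul_eq_mul,
      ← unitPt_pow] using this
  have h3 := hS.mapL (ContinuousMap.toLp 2 freqMeasure ℂ)
  simp only [map_smul] at h3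
  have h4 := (hasSum_hardyLp (summable_norm_sq hc)).unique h3
  rw [h4]
  filter_upwards [ContinuousMap.coeFn_toLp (𝕜 := ℂ) (p := 2) freqMeasure S] with x hx
  rw [hx, h2]

/-- The energy estimate of `tsum_conv_outerCoeff_le` for the real part `g` of a polynomial, where the
outer function is continuous up to the unit circle and has modulus `exp g` there. -/
theorem tsum_conv_outerCoeff_re_eval_le {c : ℕ → ℂ} (hc : Summable fun t => ‖c t‖ ^ 2)
    (p : Polynomial ℂ) :
    ∑' n, ‖conv c (outerCoeff fun x => (p.eval (unitPt x)).re) n‖ₑ ^ 2 ≤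
      ∫⁻ x, ‖hardyLp c x‖ₑ ^ 2 * ENNReal.ofReal (Real.exp (2 * (p.eval (unitPt x)).re))
        ∂freqMeasure := by
  have hs := summable_outerCoeff_re_eval p
  refine (tsum_conv_le hc (summable_norm_sq hs)).trans_eq (lintegral_congr_ae ?_)
  filter_upwards [hardyLp_eq_of_hasSum hs fun x => hasSum_outerCoeff_re_eval p (unitPt x)] with x hx
  rw [enorm_mul, mul_pow, hx, ← ofReal_norm (Complex.exp _), ← ENNReal.ofReal_pow (norm_nonneg _),
    Complex.norm_exp, ← Real.exp_nat_mul]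
  simp

/-- Fatou's lemma, through the convergence of each coefficient, for the energy of a convolution with an outer function. -/
theorem tsum_conv_outerCoeff_le_of_tendsto {c : ℕ → ℂ} {g : ℕ → Freq → ℝ} {g' : Freq → ℝ}
    (hg : ∀ k, Integrable (g k) freqMeasure) (hg' : Integrable g' freqMeasure)
    (h : Tendsto (fun k => ∫ x, |g k x - g' x| ∂freqMeasure) atTop (𝓝 0))
    {b : ℕ → ℝ≥0∞} {b' : ℝ≥0∞} (hb : Tendsto b atTop (𝓝 b'))
    (hle : ∀ k, ∑' n, ‖conv c (outerCoeff (g k)) n‖ₑ ^ 2 ≤ b k) :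
    ∑' n, ‖conv c (outerCoeff g') n‖ₑ ^ 2 ≤ b' := by
  rw [ENNReal.tsum_eq_iSup_sum]
  refine iSup_le fun s => le_of_tendsto_of_tendsto' (f := fun k =>
    ∑ n ∈ s, ‖conv c (outerCoeff (g k)) n‖ₑ ^ 2) ?_ hb
    fun k => (ENNReal.sum_le_tsum s).trans (hle k)
  refine tendsto_finsetSum _ fun n _ => ENNReal.Tendsto.pow ?_
  refine (continuous_enorm.tendsto _).comp ?_
  exact tendsto_finsetSum _ fun x _ => (tendsto_outerCoeff hg hg' h _).const_mul _

theorem lintegral_hardyLp_ne_top (c : ℕ → ℂ) :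
    ∫⁻ x, ‖hardyLp c x‖ₑ ^ 2 ∂freqMeasure ≠ ⊤ := by
  rw [lintegral_enorm_sq_Lp]; exact ENNReal.ofReal_ne_top

theorem tendsto_integral_abs_sub {g : ℕ → Freq → ℝ} {g' bound : Freq → ℝ}
    (hg : ∀ k, AEStronglyMeasurable (g k) freqMeasure) (hg' : AEStronglyMeasurable g' freqMeasure)
    (hb : Integrable bound freqMeasure) (hle : ∀ k x, |g k x - g' x| ≤ bound x)
    (hlim : ∀ᵐ x ∂freqMeasure, Tendsto (fun k => g k x) atTop (𝓝 (g' x))) :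
    Tendsto (fun k => ∫ x, |g k x - g' x| ∂freqMeasure) atTop (𝓝 0) := by
  have := tendsto_integral_of_dominated_convergence (μ := freqMeasure)
    (F := fun k x => |g k x - g' x|) (f := fun _ => (0 : ℝ)) bound
    (fun k => ((hg k).sub hg').norm) hb
    (fun k => Eventually.of_forall fun x => by simpa using hle k x) (by
      filter_upwards [hlim] with x hx
      simpa using (hx.sub_const (g' x)).abs)
  simpa using this

theorem tendsto_lintegral_weight {c : ℕ → ℂ} {g : ℕ → Freq → ℝ} {g' : Freq → ℝ}
    (hg : ∀ k, AEStronglyMeasurable (g k) freqMeasure) (bound : Freq → ℝ≥0∞)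
    (hb : ∫⁻ x, ‖hardyLp c x‖ₑ ^ 2 * bound x ∂freqMeasure ≠ ⊤)
    (hle : ∀ k x, ENNReal.ofReal (Real.exp (2 * g k x)) ≤ bound x)
    (hlim : ∀ᵐ x ∂freqMeasure, Tendsto (fun k => g k x) atTop (𝓝 (g' x))) :
    Tendsto (fun k => ∫⁻ x, ‖hardyLp c x‖ₑ ^ 2 * ENNReal.ofReal (Real.exp (2 * g k x)) ∂freqMeasure)
      atTop (𝓝 (∫⁻ x, ‖hardyLp c x‖ₑ ^ 2 * ENNReal.ofReal (Real.exp (2 * g' x)) ∂freqMeasure)) := by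
  refine tendsto_lintegral_of_dominated_convergence' (fun x => ‖hardyLp c x‖ₑ ^ 2 * bound x)
    (fun k => ?_) (fun k => Eventually.of_forall fun x => mul_le_mul' le_rfl (hle k x)) hb ?_
  · exact ((Lp.stronglyMeasurable _).enorm.pow_const 2).aemeasurable.mul
      (Real.measurable_exp.comp_aemeasurable ((hg k).aemeasurable.const_mul 2)).ennreal_ofReal
  · filter_upwards [hlim] with x hx
    refine ENNReal.Tendsto.const_mul ?_ (Or.inr (by finiteness))
    exact ENNReal.tendsto_ofReal ((Real.continuous_exp.tendsto _).comp (hx.const_mul 2))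

theorem tsum_conv_outerCoeff_le_of_bounded {c : ℕ → ℂ} (hc : Summable fun t => ‖c t‖ ^ 2)
    {g : Freq → ℝ} (hg : AEStronglyMeasurable g freqMeasure) {M : ℝ} (hM : ∀ x, |g x| ≤ M) :
    ∑' n, ‖conv c (outerCoeff g) n‖ₑ ^ 2 ≤
      ∫⁻ x, ‖hardyLp c x‖ₑ ^ 2 * ENNReal.ofReal (Real.exp (2 * g x)) ∂freqMeasure := by
  obtain ⟨p, hp, hlim⟩ := exists_seq_polynomial_tendsto hg hM
  have hm := fun k => (continuous_re_eval (p k)).aestronglyMeasurable (μ := freqMeasure)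
  refine tsum_conv_outerCoeff_le_of_tendsto (fun k => integrable_re_eval (p k))
    (Integrable.of_bound hg M (Eventually.of_forall hM))
    (tendsto_integral_abs_sub hm hg (integrable_const (M + 1 + M))
      (fun k x => (abs_sub _ _).trans (add_le_add (hp k x) (hM x))) hlim)
    (tendsto_lintegral_weight hm (fun _ => ENNReal.ofReal (Real.exp (2 * (M + 1)))) ?_
      (fun k x => ?_) hlim)
    fun k => tsum_conv_outerCoeff_re_eval_le hc (p k)
  · rw [lintegral_mul_const' _ _ ENNReal.ofReal_ne_top]
    exact ENNReal.mul_ne_top (lintegral_hardyLp_ne_top c) ENNReal.ofReal_ne_top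
  · have := (abs_le.1 (hp k x)).2
    gcongr

/-- The energy of the cascade of a filter `c` and of an outer filter with boundary modulus `exp g`
is at most its expected value `∫ |c|² exp (2 g)`. Boundary values of outer functions are not involved. -/
theorem tsum_conv_outerCoeff_le {c : ℕ → ℂ} (hc : Summable fun t => ‖c t‖ ^ 2)
    {g : Freq → ℝ} (hg : Integrable g freqMeasure) :
    ∑' n, ‖conv c (outerCoeff g) n‖ₑ ^ 2 ≤
      ∫⁻ x, ‖hardyLp c x‖ₑ ^ 2 * ENNReal.ofReal (Real.exp (2 * g x)) ∂freqMeasure := by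
  by_cases htop : ∫⁻ x, ‖hardyLp c x‖ₑ ^ 2 * ENNReal.ofReal (Real.exp (2 * g x)) ∂freqMeasure = ⊤
  · rw [htop]; exact le_top
  -- the clipped functions tend to `g`, and `exp (2 gk) ≤ 1 + exp (2 g)`
  set gk : ℕ → Freq → ℝ := fun N x => max (-N) (min N (g x)) with hgk
  have hm : ∀ N, AEStronglyMeasurable (gk N) freqMeasure := fun N =>
    aestronglyMeasurable_const.sup (aestronglyMeasurable_const.inf hg.1)
  have hN : ∀ (N : ℕ) x, |gk N x| ≤ N := fun N x => by
    have := N.cast_nonneg (α := ℝ)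
    exact abs_le.2 ⟨le_max_left _ _, max_le (by linarith) (min_le_left _ _)⟩
  have hle : ∀ (N : ℕ) x, gk N x ≤ max 0 (g x) := fun N x =>
    max_le_max (by simp) (min_le_right _ _)
  have habs : ∀ (N : ℕ) x, |gk N x - g x| ≤ |g x| := fun N x => by
    have := N.cast_nonneg (α := ℝ)
    simp only [hgk]
    rcases max_cases (-(N : ℝ)) (min N (g x)) with h | h <;>
    rcases min_cases (N : ℝ) (g x) with h' | h' <;>
    rcases abs_cases (g x) with h'' | h'' <;>
    exact abs_le.2 ⟨by linarith, by linarith⟩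
  have hlim : ∀ x, Tendsto (fun N => gk N x) atTop (𝓝 (g x)) := fun x => by
    refine tendsto_const_nhds.congr' ?_
    filter_upwards [eventually_ge_atTop ⌈|g x|⌉₊] with N hN
    have := abs_le.1 ((Nat.le_ceil _).trans (Nat.cast_le.2 hN))
    simp only [hgk]
    rw [min_eq_right this.2, max_eq_right this.1]
  refine tsum_conv_outerCoeff_le_of_tendsto
    (fun N => Integrable.of_bound (hm N) N (Eventually.of_forall (hN N))) hg
    (tendsto_integral_abs_sub hm hg.1 hg.norm habs (Eventually.of_forall hlim))
    (tendsto_lintegral_weight hm (fun x => 1 + ENNReal.ofReal (Real.exp (2 * g x))) ?_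
      (fun N x => ?_) (Eventually.of_forall hlim))
    fun N => tsum_conv_outerCoeff_le_of_bounded hc (hm N) (hN N)
  · simp only [mul_add, mul_one]
    rw [lintegral_add_left ((Lp.stronglyMeasurable _).enorm.pow_const 2)]
    exact ENNReal.add_ne_top.2 ⟨lintegral_hardyLp_ne_top c, htop⟩
  · rcases max_cases 0 (g x) with h | h
    · refine le_add_right ?_
      rw [← ENNReal.ofReal_one]
      refine ENNReal.ofReal_le_ofReal (Real.exp_le_one_iff.2 ?_)
      linarith [hle N x]
    · refine le_add_left (ENNReal.ofReal_le_ofReal (Real.exp_le_exp.2 ?_))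
      linarith [hle N x]

/-! ### Algebra of causal filters -/

theorem sum_antidiagonal_assoc {V : Type*} [AddCommMonoid V] (f : ℕ → ℕ → ℕ → V) (t : ℕ) :
    ∑ x ∈ Finset.HasAntidiagonal.antidiagonal t,
        ∑ y ∈ Finset.HasAntidiagonal.antidiagonal x.1, f y.1 y.2 x.2 =
      ∑ x ∈ Finset.HasAntidiagonal.antidiagonal t,
        ∑ y ∈ Finset.HasAntidiagonal.antidiagonal x.2, f x.1 y.1 y.2 := by
  rw [Finset.sum_sigma', Finset.sum_sigma']
  refine Finset.sum_nbij' (fun x => ⟨(x.2.1, x.2.2 + x.1.2), (x.2.2, x.1.2)⟩)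
    (fun x => ⟨(x.1.1 + x.2.1, x.2.2), (x.1.1, x.2.1)⟩) ?_ ?_ ?_ ?_ ?_
  · rintro ⟨⟨a, b⟩, ⟨c, d⟩⟩ h
    simp only [Finset.mem_sigma, Finset.HasAntidiagonal.mem_antidiagonal] at h ⊢
    exact ⟨by omega, trivial⟩
  · rintro ⟨⟨a, b⟩, ⟨c, d⟩⟩ h
    simp only [Finset.mem_sigma, Finset.HasAntidiagonal.mem_antidiagonal] at h ⊢
    exact ⟨by omega, trivial⟩
  · rintro ⟨⟨a, b⟩, ⟨c, d⟩⟩ h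
    simp only [Finset.mem_sigma, Finset.HasAntidiagonal.mem_antidiagonal] at h
    obtain ⟨-, rfl⟩ := h
    rfl
  · rintro ⟨⟨a, b⟩, ⟨c, d⟩⟩ h
    simp only [Finset.mem_sigma, Finset.HasAntidiagonal.mem_antidiagonal] at h
    obtain ⟨-, rfl⟩ := h
    rfl
  · intro x _; rfl

theorem comp_assoc {m q r p : ℕ} (K : CausalFilter r p) (H : CausalFilter q r)
    (J : CausalFilter m q) : (K.comp H).comp J = K.comp (H.comp J) := by
  funext t
  simp only [CausalFilter.comp, Matrix.sum_mul, Matrix.mul_sum]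
  rw [sum_antidiagonal_assoc (fun a b c => K a * H b * J c)]
  simp only [Matrix.mul_assoc]

theorem comp_one {m p : ℕ} (K : CausalFilter m p) : K.comp (CausalFilter.one m) = K := by
  funext t
  rw [CausalFilter.comp, Finset.sum_eq_single (t, 0)]
  · simp [CausalFilter.one]
  · rintro ⟨a, b⟩ h hne
    rw [Finset.HasAntidiagonal.mem_antidiagonal] at h
    have : b ≠ 0 := by
      rintro rfl
      exact hne (by simpa using h)
    simp [CausalFilter.one, this]
  · intro h
    simp at h

theorem one_comp {m p : ℕ} (K : CausalFilter m p) : (CausalFilter.one p).comp K = K := by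
  funext t
  rw [CausalFilter.comp, Finset.sum_eq_single (0, t)]
  · simp [CausalFilter.one]
  · rintro ⟨a, b⟩ h hne
    rw [Finset.HasAntidiagonal.mem_antidiagonal] at h
    have : a ≠ 0 := by
      rintro rfl
      exact hne (by simpa using h)
    simp [CausalFilter.one, this]
  · intro h
    simp at h

theorem comp_apply {m q p : ℕ} (K : CausalFilter q p) (H : CausalFilter m q) (u : Signal m) :
    (K.comp H).apply u = K.apply (H.apply u) := by
  funext t
  simp only [CausalFilter.comp, CausalFilter.apply, Matrix.sum_mulVec, Matrix.mulVec_sum]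
  rw [sum_antidiagonal_assoc (fun a b c => (K a * H b).mulVec (u c))]
  simp only [Matrix.mulVec_mulVec]

theorem apply_add {m p : ℕ} (K : CausalFilter m p) (u w : Signal m) :
    K.apply (u + w) = K.apply u + K.apply w := by
  funext t
  simp only [CausalFilter.apply, Pi.add_apply, Matrix.mulVec_add, Finset.sum_add_distrib]

theorem apply_sub {m p : ℕ} (K : CausalFilter m p) (u w : Signal m) :
    K.apply (u - w) = K.apply u - K.apply w := by
  funext t
  simp only [CausalFilter.apply, Pi.sub_apply, Matrix.mulVec_sub, Finset.sum_sub_distrib]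

/-! ### Energy of a filter and sensitivity -/

/-- The squared `H₂` norm of a filter. -/
noncomputable def energy {m p : ℕ} (H : CausalFilter m p) : ℝ≥0∞ :=
  ∑' t, ENNReal.ofReal (∑ i, ∑ j, H t i j ^ 2)

theorem h2Norm_sq {m p : ℕ} (H : CausalFilter m p) : h2Norm H ^ 2 = energy H := by
  rw [h2Norm, ← ENNReal.rpow_natCast, ← ENNReal.rpow_mul]
  norm_num [energy]

theorem h2Norm_lt_top_iff {m p : ℕ} (H : CausalFilter m p) : h2Norm H < ⊤ ↔ energy H < ⊤ := by
  rw [← h2Norm_sq, ENNReal.pow_lt_top_iff]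
  simp

theorem tsum_shift (h : ℕ → ℝ≥0∞) (τ : ℕ) :
    ∑' t, (if τ ≤ t then h (t - τ) else 0) = ∑' t, h t := by
  rw [← (add_left_injective τ).tsum_eq (f := fun t => if τ ≤ t then h (t - τ) else 0)]
  · simp
  · intro t ht
    have h1 : τ ≤ t := by
      by_contra hlt
      simp [hlt] at ht
    exact ⟨t - τ, Nat.sub_add_cancel h1⟩

/-- The response of a single-input filter to an impulse. -/
theorem signalNorm_apply_impulse {q : ℕ} (G : CausalFilter 1 q) {v : Signal 1} {τ : ℕ} {α : ℝ}
    (hv : ∀ t, v t 0 = if t = τ then α else 0) :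
    signalNorm (G.apply v) = ENNReal.ofReal |α| * h2Norm G := by
  have h1 : ∀ t i, G.apply v t i = if τ ≤ t then α * G (t - τ) i 0 else 0 := by
    intro t i
    simp only [CausalFilter.apply, Finset.sum_apply, Matrix.mulVec, dotProduct, Fin.sum_univ_one,
      Fin.isValue, hv]
    split_ifs with h
    · rw [Finset.sum_eq_single (t - τ, τ)]
      · rw [if_pos rfl, mul_comm]
      · rintro ⟨a, b⟩ hab hne
        rw [Finset.HasAntidiagonal.mem_antidiagonal] at hab
        rw [if_neg, mul_zero]
        rintro rfl
        exact hne (Prod.ext (by simp only at hab ⊢; omega) rfl)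
      · intro hn
        rw [Finset.HasAntidiagonal.mem_antidiagonal] at hn
        omega
    · refine Finset.sum_eq_zero fun x hx => ?_
      rw [Finset.HasAntidiagonal.mem_antidiagonal] at hx
      rw [if_neg (by omega), mul_zero]
  have h2 : ∀ t, ENNReal.ofReal (sqNorm (G.apply v t)) =
      if τ ≤ t then ENNReal.ofReal (α ^ 2) * ENNReal.ofReal (∑ i, ∑ j, G (t - τ) i j ^ 2)
        else 0 := by
    intro t
    simp only [sqNorm, h1]
    split_ifs with h
    · rw [← ENNReal.ofReal_mul (sq_nonneg _)]
      simp [mul_pow, Finset.mul_sum]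
    · simp
  rw [signalNorm]
  simp only [h2]
  rw [tsum_shift (fun t => ENNReal.ofReal (α ^ 2) * ENNReal.ofReal (∑ i, ∑ j, G t i j ^ 2)),
    ENNReal.tsum_mul_left, ENNReal.mul_rpow_of_nonneg _ _ (by norm_num), h2Norm,
    ENNReal.ofReal_rpow_of_nonneg (sq_nonneg _) (by norm_num), ← sq_abs, ← Real.sqrt_eq_rpow,
    Real.sqrt_sq (abs_nonneg _)]

/-- The `ℓ₂`-sensitivity of a single-input filter is proportional to its `H₂` norm. -/
theorem sensitivity_eq {q : ℕ} (G : CausalFilter 1 q) {k₁ : ℝ} (hk : 0 ≤ k₁) :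
    sensitivity (fun _ => k₁) G = ENNReal.ofReal k₁ * h2Norm G := by
  apply le_antisymm
  · refine iSup_le fun u => iSup_le fun u' => iSup_le fun h => ?_
    obtain ⟨τ, α, hα, ht⟩ := h 0
    rw [← apply_sub, signalNorm_apply_impulse G (v := u - u') (τ := τ) (α := -α), abs_neg]
    · gcongr
    · intro t
      have := ht t
      rw [Pi.sub_apply, Pi.sub_apply]
      split_ifs at this ⊢ with h <;> linarith
  -- the supremum is attained by an impulse of the maximal height `k₁`
  · let u : Signal 1 := fun t _ => if t = 0 then k₁ else 0
    have h1 : Adj (fun _ : Fin 1 => k₁) u 0 := fun i =>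
      ⟨0, -k₁, by rw [abs_neg, abs_of_nonneg hk], fun t => by
        by_cases h : t = 0 <;> simp [u, h]⟩
    refine le_trans (le_of_eq ?_) (le_iSup_of_le u (le_iSup_of_le 0 (le_iSup_of_le h1 le_rfl)))
    rw [← apply_sub, signalNorm_apply_impulse G (v := u - 0) (τ := 0) (α := k₁), abs_of_nonneg hk]
    intro t
    simp [u]

theorem noiseVariance_eq {q : ℕ} {k₁ δ ε : ℝ} (hk : 0 ≤ k₁) {G : CausalFilter 1 q}
    (hG : IsStableFilter G) :
    (noiseVariance k₁ δ ε G : ℝ≥0∞) = ENNReal.ofReal (k₁ ^ 2 * kappa δ ε ^ 2) * energy G := by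
  have hG' : energy G ≠ ⊤ := ((h2Norm_lt_top_iff G).1 hG).ne
  rw [noiseVariance, sensitivity_eq G hk, mul_pow, h2Norm_sq, ← ENNReal.ofReal_pow hk, ← mul_assoc,
    ← ENNReal.ofReal_mul (sq_nonneg _), mul_comm (kappa δ ε ^ 2), ENNReal.coe_toNNReal]
  exact ENNReal.mul_ne_top ENNReal.ofReal_ne_top hG'

/-! ### The mean square error -/

/-- Cesàro means of a nondecreasing sequence tend to its supremum, in `[0, ∞]`. -/
theorem tendsto_cesaro_of_monotone {b : ℕ → ℝ≥0∞} (hb : Monotone b) :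
    Tendsto (fun T : ℕ => (∑ t ∈ Finset.range T, b t) / (T : ℝ≥0∞)) atTop (𝓝 (⨆ t, b t)) := by
  refine tendsto_order.2 ⟨fun a ha => ?_, fun a ha => ?_⟩
  · obtain ⟨a', haa', ha'⟩ := exists_between ha
    obtain ⟨N, hN⟩ := lt_iSup_iff.1 ha'
    lift a to NNReal using haa'.ne_top
    lift a' to NNReal using hN.ne_top
    have haa : (a : ℝ) < a' := by exact_mod_cast haa'
    obtain ⟨T₀, hT₀⟩ := exists_nat_gt ((a' : ℝ) * N / (a' - a))
    filter_upwards [eventually_ge_atTop (max T₀ (N + 1))] with T hT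
    have hTN : N < T := by omega
    have hT₁ : (T₀ : ℝ) ≤ T := by exact_mod_cast (le_max_left _ _).trans hT
    have h1 : (a : ℝ) * T < a' * (T - N : ℕ) := by
      rw [div_lt_iff₀ (by linarith)] at hT₀
      push_cast [hTN.le]
      nlinarith
    have h2 : (a : ℝ≥0∞) * T < a' * (T - N : ℕ) := by exact_mod_cast h1
    rw [ENNReal.lt_div_iff_mul_lt (Or.inl (by simp; omega)) (Or.inl (by simp))]
    refine h2.trans_le ?_
    calc (a' : ℝ≥0∞) * (T - N : ℕ) ≤ ∑ t ∈ Finset.Ico N T, b t := by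
          rw [mul_comm, ← nsmul_eq_mul, ← Nat.card_Ico, ← Finset.sum_const]
          exact Finset.sum_le_sum fun t ht => hN.le.trans (hb (Finset.mem_Ico.1 ht).1)
      _ ≤ _ := Finset.sum_le_sum_of_subset fun t ht =>
          Finset.mem_range.2 (Finset.mem_Ico.1 ht).2
  · refine Eventually.of_forall fun T => lt_of_le_of_lt (ENNReal.div_le_of_le_mul ?_) ha
    rw [mul_comm]
    calc _ ≤ ∑ t ∈ Finset.range T, ⨆ t, b t := Finset.sum_le_sum fun t _ => le_iSup b t
      _ = _ := by simp

/-- The second moment of a linear combination of independent centered Gaussian variables. -/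
theorem lintegral_sq_sum_gaussian {Ω ι : Type*} [MeasurableSpace Ω] {P : Measure Ω}
    [IsProbabilityMeasure P] {v : NNReal} {X : ι → Ω → ℝ} (hi : iIndepFun X P)
    (hX : ∀ i, HasLaw (X i) (gaussianReal 0 v) P) (s : Finset ι) (a : ι → ℝ) :
    ∫⁻ ω, ENNReal.ofReal ((∑ i ∈ s, a i * X i ω) ^ 2) ∂P = v * ENNReal.ofReal (∑ i ∈ s, a i ^ 2) := by
  have hL : ∀ i, MemLp (X i) 2 P := fun i => by
    have h := memLp_id_gaussianReal' (μ := 0) (v := v) 2 (by simp)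
    rw [← (hX i).map_eq] at h
    exact h.comp_of_map (hX i).aemeasurable
  have haL : ∀ i, MemLp (fun ω => a i * X i ω) 2 P := fun i => (hL i).const_mul (a i)
  have hsL : MemLp (∑ i ∈ s, fun ω => a i * X i ω) 2 P := memLp_finsetSum' s fun i _ => haL i
  have h0 : ∫ ω, (∑ i ∈ s, fun ω => a i * X i ω) ω ∂P = 0 := by
    simp only [Finset.sum_apply]
    rw [integral_finsetSum _ fun i _ => (haL i).integrable (by norm_num)]
    refine Finset.sum_eq_zero fun i _ => ?_
    rw [integral_const_mul, (hX i).integral_eq, integral_id_gaussianReal, mul_zero]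
  have hvar : variance (∑ i ∈ s, fun ω => a i * X i ω) P = v * ∑ i ∈ s, a i ^ 2 := by
    rw [IndepFun.variance_sum fun i _ => haL i, Finset.mul_sum]
    · refine Finset.sum_congr rfl fun i _ => ?_
      rw [variance_const_mul, (hX i).variance_eq, variance_id_gaussianReal, mul_comm]
    · intro i _ j _ hij
      exact (hi.indepFun hij).comp (measurable_const_mul (a i)) (measurable_const_mul (a j))
  rw [variance_of_integral_eq_zero hsL.1.aemeasurable h0] at hvar
  rw [← ofReal_integral_eq_lintegral_ofReal]
  · simp only [Finset.sum_apply] at hvar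
    rw [hvar, ENNReal.ofReal_mul NNReal.zero_le_coe, ENNReal.ofReal_coe_nnreal]
  · simpa using hsL.integrable_sq
  · exact Eventually.of_forall fun ω => sq_nonneg _

/-- The power at time `t` of a filtered white noise. -/
theorem lintegral_sqNorm_apply_whiteNoise {Ω : Type*} [MeasurableSpace Ω] {P : Measure Ω}
    [IsProbabilityMeasure P] {p q : ℕ} {v : NNReal} {w : Ω → Signal q}
    (hw : IsGaussianWhiteNoise P v w) (M : CausalFilter q p) (t : ℕ) :
    ∫⁻ a, ENNReal.ofReal (sqNorm (M.apply (w a) t)) ∂P =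
      v * ∑ s ∈ Finset.range (t + 1), ENNReal.ofReal (∑ i, ∑ j, M s i j ^ 2) := by
  have h1 : ∀ a i, M.apply (w a) t i =
      ∑ y ∈ Finset.range (t + 1) ×ˢ (Finset.univ : Finset (Fin q)),
        M (t - y.1) i y.2 * w a y.1 y.2 := fun a i => by
    rw [Finset.sum_product, CausalFilter.apply, ← Finset.Nat.sum_antidiagonal_swap,
      Finset.Nat.sum_antidiagonal_eq_sum_range_succ_mk, Finset.sum_apply]
    rfl
  have hmeas : ∀ i, AEMeasurable (fun a => ENNReal.ofReal (M.apply (w a) t i ^ 2)) P := fun i => by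
    simp only [h1]
    exact ((Finset.aemeasurable_fun_sum _ fun y _ =>
      (hw.2 y.1 y.2).aemeasurable.const_mul _).pow_const 2).ennreal_ofReal
  simp only [sqNorm]
  simp only [ENNReal.ofReal_sum_of_nonneg fun i _ => sq_nonneg _]
  rw [lintegral_finsetSum' _ fun i _ => hmeas i]
  simp only [h1]
  have h2 := fun i => lintegral_sq_sum_gaussian hw.1 (fun x => hw.2 x.1 x.2)
    (Finset.range (t + 1) ×ˢ (Finset.univ : Finset (Fin q))) fun y => M (t - y.1) i y.2
  have h3 : ∑ i, ∑ y ∈ Finset.range (t + 1) ×ˢ (Finset.univ : Finset (Fin q)),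
      M (t - y.1) i y.2 ^ 2 = ∑ s ∈ Finset.range (t + 1), ∑ i, ∑ j, M s i j ^ 2 := by
    simp only [Finset.sum_product]
    rw [Finset.sum_comm, ← Finset.sum_range_reflect]
    refine Finset.sum_congr rfl fun s hs => Finset.sum_congr rfl fun i _ => ?_
    rw [show t - (t + 1 - 1 - s) = s by have := Finset.mem_range.1 hs; omega]
  simp only [h2]
  rw [← Finset.mul_sum, ← ENNReal.ofReal_sum_of_nonneg fun i _ => Finset.sum_nonneg
    fun y _ => sq_nonneg _, h3]
  congr 1
  exact ENNReal.ofReal_sum_of_nonneg fun s _ => Finset.sum_nonneg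
    fun i _ => Finset.sum_nonneg fun j _ => sq_nonneg _

/-- The mean square error is the energy of the equalizer `F L` times the variance of the noise: the
input is reconstructed exactly, so that only the filtered noise is left. -/
theorem hasMSE {p q : ℕ} {k₁ δ ε : ℝ} (F : CausalFilter 1 p) {G : CausalFilter 1 q}
    {L : CausalFilter q 1} (hLG : IsLeftInverse L G) :
    HasMSE.{u} k₁ δ ε F G L (noiseVariance k₁ δ ε G * energy (F.comp L)) := by
  intro Ω _ P _ w hw s
  have hF : (F.comp L).comp G = F := by rw [comp_assoc, hLG, comp_one]
  have h1 : ∀ a t, sqNorm (F.apply s t - output F G L s (w a) t) =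
      sqNorm ((F.comp L).apply (w a) t) := fun a t => by
    have h2 : F.apply s = (F.comp L).apply (G.apply s) := by rw [← comp_apply, hF]
    rw [output, apply_add, ← h2, Pi.add_apply, sub_add_cancel_left]
    simp [sqNorm]
  simp only [h1, lintegral_sqNorm_apply_whiteNoise hw]
  have h3 := tendsto_cesaro_of_monotone (b := fun t => (noiseVariance k₁ δ ε G : ℝ≥0∞) *
    ∑ s ∈ Finset.range (t + 1), ENNReal.ofReal (∑ i, ∑ j, F.comp L s i j ^ 2)) (by
      refine monotone_nat_of_le_succ fun t => ?_
      gcongr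
      omega)
  rw [← ENNReal.mul_iSup] at h3
  have h4 : ⨆ t, ∑ s ∈ Finset.range (t + 1), ENNReal.ofReal (∑ i, ∑ j, F.comp L s i j ^ 2) =
      energy (F.comp L) := by
    rw [energy, ENNReal.tsum_eq_iSup_nat]
    refine le_antisymm (iSup_le fun t => le_iSup_of_le (t + 1) le_rfl)
      (iSup_le fun t => le_iSup_of_le t ?_)
    exact Finset.sum_le_sum_of_subset (Finset.range_subset_range.2 (Nat.le_succ t))
  rwa [h4] at h3

/-! ### Frequency responses on the circle -/

/-- The squared Frobenius norm of the frequency response, as a function on the circle. -/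
noncomputable def freqSq {m p : ℕ} (H : CausalFilter m p) (x : Freq) : ℝ :=
  ∑ i, ∑ j, ‖freqLp H i j x‖ ^ 2

theorem freqSq_nonneg {m p : ℕ} (H : CausalFilter m p) (x : Freq) : 0 ≤ freqSq H x :=
  Finset.sum_nonneg fun _ _ => Finset.sum_nonneg fun _ _ => sq_nonneg _

theorem measurable_freqSq {m p : ℕ} (H : CausalFilter m p) : Measurable (freqSq H) :=
  Finset.measurable_fun_sum _ fun _ _ => Finset.measurable_fun_sum _ fun _ _ =>
    (Lp.stronglyMeasurable _).norm.measurable.pow_const 2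

theorem integrable_freqSq {m p : ℕ} (H : CausalFilter m p) : Integrable (freqSq H) freqMeasure :=
  integrable_finsetSum _ fun _ _ => integrable_finsetSum _ fun _ _ =>
    (memLp_two_iff_integrable_sq_norm (Lp.memLp _).1).1 (Lp.memLp _)

theorem integrable_sqrt_freqSq {m p : ℕ} (H : CausalFilter m p) :
    Integrable (fun x => Real.sqrt (freqSq H x)) freqMeasure := by
  refine ((integrable_const 1).add (integrable_freqSq H)).mono'
    (measurable_freqSq H).sqrt.aestronglyMeasurable (Eventually.of_forall fun x => ?_)
  rw [Real.norm_of_nonneg (Real.sqrt_nonneg _), Pi.add_apply, Real.sqrt_le_left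
    (by linarith [freqSq_nonneg H x])]
  nlinarith [freqSq_nonneg H x]

theorem freqLp_eq {m p : ℕ} (H : CausalFilter m p) (i : Fin p) (j : Fin m) :
    freqLp H i j = hardyLp fun t => (H t i j : ℂ) := rfl

theorem energy_eq_sum {m p : ℕ} (H : CausalFilter m p) :
    energy H = ∑ i, ∑ j, ∑' t, ‖(H t i j : ℂ)‖ₑ ^ 2 := by
  have h : ∀ t, ENNReal.ofReal (∑ i, ∑ j, H t i j ^ 2) = ∑ i, ∑ j, ‖(H t i j : ℂ)‖ₑ ^ 2 := by
    intro t
    refine (ENNReal.ofReal_sum_of_nonneg fun i _ =>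
      Finset.sum_nonneg fun j _ => sq_nonneg _).trans (Finset.sum_congr rfl fun i _ => ?_)
    refine (ENNReal.ofReal_sum_of_nonneg fun j _ => sq_nonneg _).trans
      (Finset.sum_congr rfl fun j _ => ?_)
    rw [← ofReal_norm, ← ENNReal.ofReal_pow (norm_nonneg _), Complex.norm_real, Real.norm_eq_abs,
      sq_abs]
  simp only [energy, h]
  rw [Summable.tsum_finsetSum fun _ _ => ENNReal.summable]
  exact Finset.sum_congr rfl fun i _ => Summable.tsum_finsetSum fun _ _ => ENNReal.summable

theorem summable_entry {m p : ℕ} {H : CausalFilter m p} (hH : energy H < ⊤) (i : Fin p)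
    (j : Fin m) : Summable fun t => ‖(H t i j : ℂ)‖ ^ 2 := by
  rw [energy_eq_sum, ENNReal.sum_lt_top] at hH
  have h := ENNReal.sum_lt_top.1 (hH i (Finset.mem_univ i)) j (Finset.mem_univ j)
  have h2 := ENNReal.summable_toReal h.ne
  simpa using h2

/-- Parseval's identity for filters. -/
theorem energy_eq_integral {m p : ℕ} {H : CausalFilter m p} (hH : energy H < ⊤) :
    energy H = ENNReal.ofReal (∫ x, freqSq H x ∂freqMeasure) := by
  have hi : ∀ i j, Integrable (fun x => ‖freqLp H i j x‖ ^ 2) freqMeasure := fun i j =>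
    (memLp_two_iff_integrable_sq_norm (Lp.memLp _).1).1 (Lp.memLp _)
  have h0 : ∀ i j, 0 ≤ ∫ x, ‖freqLp H i j x‖ ^ 2 ∂freqMeasure := fun i j =>
    integral_nonneg fun x => sq_nonneg _
  simp only [freqSq]
  rw [energy_eq_sum, integral_finsetSum _ fun i _ => integrable_finsetSum _ fun j _ => hi i j,
    ENNReal.ofReal_sum_of_nonneg fun i _ => integral_nonneg fun x =>
      Finset.sum_nonneg fun j _ => sq_nonneg _]
  refine Finset.sum_congr rfl fun i _ => ?_
  rw [integral_finsetSum _ fun j _ => hi i j, ENNReal.ofReal_sum_of_nonneg fun j _ => h0 i j]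
  refine Finset.sum_congr rfl fun j _ => ?_
  rw [← lintegral_enorm_sq_Lp, freqLp_eq, lintegral_hardyLp (summable_entry hH i j)]

theorem ofReal_comp_entry {m q p : ℕ} (M : CausalFilter q p) (G : CausalFilter m q) (t : ℕ)
    (i : Fin p) (k : Fin m) : (((M.comp G) t i k : ℝ) : ℂ) =
      ∑ j, conv (fun s => (M s i j : ℂ)) (fun s => (G s j k : ℂ)) t := by
  simp only [CausalFilter.comp, conv, Matrix.sum_apply, Matrix.mul_apply]
  rw [Finset.sum_comm]
  push_cast
  rfl

/-- The frequency response of a cascade is the product of the frequency responses. -/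
theorem freqLp_comp {m q p : ℕ} {M : CausalFilter q p} {G : CausalFilter m q} (hM : energy M < ⊤)
    (hG : energy G < ⊤) (hMG : energy (M.comp G) < ⊤) (i : Fin p) (k : Fin m) :
    ∀ᵐ x ∂freqMeasure, freqLp (M.comp G) i k x = ∑ j, freqLp M i j x * freqLp G j k x := by
  have hint : ∀ j, Integrable (fun x => freqLp M i j x * freqLp G j k x) freqMeasure := fun j =>
    integrable_Lp_mul _ _
  have hsum : Integrable (fun x => ∑ j, freqLp M i j x * freqLp G j k x) freqMeasure :=
    integrable_finsetSum _ fun j _ => hint j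
  have key : (fun x => freqLp (M.comp G) i k x - ∑ j, freqLp M i j x * freqLp G j k x)
      =ᵐ[freqMeasure] 0 := by
    refine ae_eq_zero_of_fourierCoeff_eq_zero ((integrable_Lp _).sub hsum) fun n => ?_
    have h1 : fourierCoeff (fun x => freqLp (M.comp G) i k x -
        ∑ j, freqLp M i j x * freqLp G j k x) n = fourierCoeff (freqLp (M.comp G) i k) n -
          ∑ j, fourierCoeff (fun x => freqLp M i j x * freqLp G j k x) n := by
      simp only [fourierCoeff, smul_sub]
      rw [integral_sub ((integrable_Lp _).fourier_smul _) (hsum.fourier_smul _),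
        ← integral_finsetSum _ fun j _ => (hint j).fourier_smul _]
      simp only [Finset.smul_sum]
    rw [h1]
    rcases lt_or_ge 0 n with hn | hn
    · rw [freqLp_eq, fourierCoeff_hardyLp_of_pos (summable_entry hMG i k) hn, zero_sub, neg_eq_zero]
      exact Finset.sum_eq_zero fun j _ =>
        fourierCoeff_hardyLp_mul_of_pos (summable_entry hM i j) (summable_entry hG j k) hn
    · obtain ⟨t, rfl⟩ : ∃ t : ℕ, n = -(t : ℤ) := ⟨n.natAbs, by omega⟩
      rw [freqLp_eq, fourierCoeff_hardyLp (summable_entry hMG i k), ofReal_comp_entry, sub_eq_zero]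
      exact Finset.sum_congr rfl fun j _ => (fourierCoeff_hardyLp_mul (summable_entry hM i j)
        (summable_entry hG j k) t).symm
  filter_upwards [key] with x hx
  exact sub_eq_zero.1 hx

/-- The frequency response of a cascade is submultiplicative in norm. -/
theorem freqSq_comp_le {m q p : ℕ} {M : CausalFilter q p} {G : CausalFilter m q} (hM : energy M < ⊤)
    (hG : energy G < ⊤) (hMG : energy (M.comp G) < ⊤) :
    ∀ᵐ x ∂freqMeasure, freqSq (M.comp G) x ≤ freqSq M x * freqSq G x := by
  have h := ae_all_iff.2 fun i => ae_all_iff.2 fun k => freqLp_comp hM hG hMG i k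
  filter_upwards [h] with x hx
  simp only [freqSq, hx]
  rw [Finset.sum_mul]
  refine Finset.sum_le_sum fun i _ => ?_
  rw [Finset.sum_comm (s := (Finset.univ : Finset (Fin q))), Finset.mul_sum]
  refine Finset.sum_le_sum fun k _ => ?_
  refine le_trans ?_ (Finset.sum_mul_sq_le_sq_mul_sq Finset.univ
    (fun j => ‖freqLp M i j x‖) fun j => ‖freqLp G j k x‖)
  refine pow_le_pow_left₀ (norm_nonneg _) ((norm_sum_le _ _).trans_eq ?_) 2
  simp only [norm_mul]

theorem sqrt_freqSq_comp_le {m q p : ℕ} {M : CausalFilter q p} {G : CausalFilter m q}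
    (hM : energy M < ⊤) (hG : energy G < ⊤) (hMG : energy (M.comp G) < ⊤) :
    ∀ᵐ x ∂freqMeasure, Real.sqrt (freqSq (M.comp G) x) ≤
      Real.sqrt (freqSq M x) * Real.sqrt (freqSq G x) := by
  filter_upwards [freqSq_comp_le hM hG hMG] with x hx
  rw [← Real.sqrt_mul (freqSq_nonneg M x)]
  exact Real.sqrt_le_sqrt hx

/-- The Cauchy–Schwarz inequality behind the lower bound on the mean square error. -/
theorem sq_integral_le {m q p : ℕ} {M : CausalFilter q p} {G : CausalFilter m q}
    (hM : energy M < ⊤) (hG : energy G < ⊤) (hMG : energy (M.comp G) < ⊤) :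
    (∫ x, Real.sqrt (freqSq (M.comp G) x) ∂freqMeasure) ^ 2 ≤
      (∫ x, freqSq M x ∂freqMeasure) * ∫ x, freqSq G x ∂freqMeasure := by
  set a := ∫ x, freqSq M x ∂freqMeasure
  set b := ∫ x, freqSq G x ∂freqMeasure
  set c := ∫ x, Real.sqrt (freqSq (M.comp G) x) ∂freqMeasure
  have hc : 0 ≤ c := integral_nonneg fun x => Real.sqrt_nonneg _
  -- the quadratic polynomial `∫ (s |M| - |G|)²`, with `|M| |G|` bounded below by `|M G|`
  have key : ∀ s : ℝ, 0 ≤ a * (s * s) + (-(2 * c)) * s + b := by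
    intro s
    rcases le_total s 0 with hs | hs
    · have ha : 0 ≤ a := integral_nonneg (freqSq_nonneg M)
      have hb : 0 ≤ b := integral_nonneg (freqSq_nonneg G)
      nlinarith [mul_nonneg ha (mul_self_nonneg s), mul_nonneg hc (neg_nonneg.2 hs)]
    · have h1 : a * (s * s) + (-(2 * c)) * s + b = ∫ x, (s * s * freqSq M x -
          2 * s * Real.sqrt (freqSq (M.comp G) x) + freqSq G x) ∂freqMeasure := by
        have i1 := (integrable_freqSq M).const_mul (s * s)
        have i2 := (integrable_sqrt_freqSq (M.comp G)).const_mul (2 * s)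
        have i3 : Integrable (fun x => s * s * freqSq M x - 2 * s * Real.sqrt (freqSq (M.comp G) x))
          freqMeasure := i1.sub i2
        rw [integral_add i3 (integrable_freqSq G), integral_sub i1 i2, integral_const_mul,
          integral_const_mul]
        ring
      rw [h1]
      refine integral_nonneg_of_ae ?_
      filter_upwards [sqrt_freqSq_comp_le hM hG hMG] with x hx
      have h2 := Real.sq_sqrt (freqSq_nonneg M x)
      have h3 := Real.sq_sqrt (freqSq_nonneg G x)
      have h4 := mul_le_mul_of_nonneg_left hx hs
      show (0 : ℝ) ≤ _
      nlinarith [sq_nonneg (s * Real.sqrt (freqSq M x) - Real.sqrt (freqSq G x))]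
  have h := discrim_le_zero key
  rw [discrim] at h
  nlinarith

/-! ### From the circle to the interval `[-π, π)` -/

theorem measurePreserving_coe : MeasurePreserving (fun ω : ℝ => (ω : Freq))
    ((volume : Measure ℝ).restrict (Set.Ico (-Real.pi) Real.pi))
    (ENNReal.ofReal (2 * Real.pi) • freqMeasure) := by
  have h := AddCircle.measurePreserving_mk (2 * Real.pi) (-Real.pi)
  rw [show -Real.pi + 2 * Real.pi = Real.pi by ring, AddCircle.volume_eq_smul_haarAddCircle] at h
  rwa [Measure.restrict_congr_set Ico_ae_eq_Ioc]

theorem ae_coe {P : Freq → Prop} (h : ∀ᵐ x ∂freqMeasure, P x) :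
    ∀ᵐ ω : ℝ ∂volume.restrict (Set.Ico (-Real.pi) Real.pi), P (ω : Freq) :=
  measurePreserving_coe.quasiMeasurePreserving.ae (Measure.smul_absolutelyContinuous.ae_le h)

theorem ae_of_ae_coe {P : Freq → Prop} (hP : MeasurableSet {x | P x})
    (h : ∀ᵐ ω : ℝ ∂volume.restrict (Set.Ico (-Real.pi) Real.pi), P (ω : Freq)) :
    ∀ᵐ x ∂freqMeasure, P x := by
  have h1 := (ae_map_iff measurePreserving_coe.measurable.aemeasurable hP).2 h
  rw [measurePreserving_coe.map_eq, Measure.ae_ennreal_smul_measure_iff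
    (by simpa using Real.pi_pos)] at h1
  exact h1

theorem integrableOn_coe_iff {f : Freq → ℝ} (hf : Measurable f) :
    IntegrableOn (fun ω : ℝ => f ω) (Set.Ico (-Real.pi) Real.pi) ↔ Integrable f freqMeasure := by
  have h := measurePreserving_coe.integrable_comp (g := f) hf.aestronglyMeasurable
  rw [integrable_smul_measure (by simpa using Real.pi_pos) ENNReal.ofReal_ne_top] at h
  exact h

theorem intervalIntegral_coe {E : Type*} [NormedAddCommGroup E] [NormedSpace ℝ E] (f : Freq → E) :
    (1 / (2 * Real.pi)) • ∫ ω in (-Real.pi)..Real.pi, f ω = ∫ x, f x ∂freqMeasure := by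
  have h := AddCircle.intervalIntegral_preimage (2 * Real.pi) (-Real.pi) f
  rw [show -Real.pi + 2 * Real.pi = Real.pi by ring] at h
  rw [h, AddCircle.volume_eq_smul_haarAddCircle, integral_smul_measure,
    ENNReal.toReal_ofReal Real.two_pi_pos.le, smul_smul, one_div_mul_cancel Real.two_pi_pos.ne',
    one_smul]

theorem freqNorm_eq {p : ℕ} (F : CausalFilter 1 p) (ω : ℝ) :
    freqNorm F ω = Real.sqrt (freqSq F (ω : Freq)) := by
  simp only [freqNorm, freqSq, Fin.sum_univ_one]
  rfl

theorem mseBound_eq {p : ℕ} (k₁ δ ε : ℝ) (F : CausalFilter 1 p) :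
    mseBound k₁ δ ε F = k₁ ^ 2 * kappa δ ε ^ 2 *
      (∫ x, Real.sqrt (freqSq F x) ∂freqMeasure) ^ 2 := by
  rw [mseBound, ← intervalIntegral_coe]
  simp only [freqNorm_eq, smul_eq_mul]

/-! ### The lower bound -/

theorem kappa_pos (δ : ℝ) {ε : ℝ} (hε : 0 < ε) : 0 < kappa δ ε := by
  have h : -gaussianQInv δ < Real.sqrt (gaussianQInv δ ^ 2 + 2 * ε) :=
    Real.lt_sqrt_of_sq_lt (by nlinarith)
  exact mul_pos (by positivity) (by linarith)

theorem energy_ne_zero {q : ℕ} {G : CausalFilter 1 q} {L : CausalFilter q 1}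
    (h : IsLeftInverse L G) : energy G ≠ 0 := by
  intro h0
  have h1 : ∀ t i j, G t i j = 0 := by
    intro t i j
    have h2 := ENNReal.ofReal_eq_zero.1 (ENNReal.tsum_eq_zero.1 h0 t)
    have h3 := (Finset.sum_eq_zero_iff_of_nonneg fun i _ => Finset.sum_nonneg fun j _ =>
      sq_nonneg _).1 (le_antisymm h2 (Finset.sum_nonneg fun i _ => Finset.sum_nonneg fun j _ =>
        sq_nonneg _)) i (Finset.mem_univ i)
    have h4 := (Finset.sum_eq_zero_iff_of_nonneg fun j _ => sq_nonneg _).1 h3 j (Finset.mem_univ j)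
    exact pow_eq_zero_iff (two_ne_zero) |>.1 h4
  have h2 := congrFun (congrFun (congrFun h 0) 0) 0
  simp [CausalFilter.comp, CausalFilter.one, Matrix.mul_apply, h1] at h2

/-- The lower bound on the mean square error. If the equalizer `F L` is unstable, the error is
infinite, since the noise does not vanish. -/
theorem ofReal_mseBound_le {p q : ℕ} {k₁ δ ε : ℝ} (hk : 0 < k₁) (hε : 0 < ε)
    {F : CausalFilter 1 p} (hF : energy F < ⊤) {G : CausalFilter 1 q} (hG : IsStableFilter G)
    {L : CausalFilter q 1} (hLG : IsLeftInverse L G) :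
    ENNReal.ofReal (mseBound k₁ δ ε F) ≤ noiseVariance k₁ δ ε G * energy (F.comp L) := by
  have hG' := (h2Norm_lt_top_iff G).1 hG
  have hκ : 0 < k₁ ^ 2 * kappa δ ε ^ 2 := by have := kappa_pos δ hε; positivity
  rw [noiseVariance_eq hk.le hG]
  by_cases hM : energy (F.comp L) = ⊤
  · rw [hM, ENNReal.mul_top]
    · exact le_top
    · exact mul_ne_zero (ENNReal.ofReal_pos.2 hκ).ne' (energy_ne_zero hLG)
  · have hM' := lt_top_iff_ne_top.2 hM
    have hc : (F.comp L).comp G = F := by rw [comp_assoc, hLG, comp_one]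
    have h := sq_integral_le hM' hG' (by rwa [hc])
    rw [hc] at h
    rw [energy_eq_integral hM', energy_eq_integral hG', mul_assoc,
      ← ENNReal.ofReal_mul (integral_nonneg (freqSq_nonneg G)), ← ENNReal.ofReal_mul hκ.le,
      mseBound_eq]
    refine ENNReal.ofReal_le_ofReal (mul_le_mul_of_nonneg_left ?_ hκ.le)
    exact h.trans_eq (mul_comm _ _)

/-! ### The optimal filter -/

/-- A filter with real coefficients has a conjugate-symmetric frequency response. -/
theorem conj_hardyLp_neg {c : ℕ → ℝ} (hc : Summable fun t => ‖(c t : ℂ)‖ ^ 2) :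
    ∀ᵐ x ∂freqMeasure, hardyLp (fun t => (c t : ℂ)) (-x) =
      starRingEnd ℂ (hardyLp (fun t => (c t : ℂ)) x) := by
  set f := hardyLp fun t => (c t : ℂ) with hf
  have hmp := Measure.measurePreserving_neg (freqMeasure)
  have hneg : Integrable (fun x => f (-x)) freqMeasure := hmp.integrable_comp_of_integrable
    (integrable_Lp f)
  have hconj : Integrable (fun x => starRingEnd ℂ (f x)) freqMeasure :=
    (integrable_Lp f).norm.mono' (Complex.continuous_conj.comp_aestronglyMeasurable (Lp.memLp f).1)
      (Eventually.of_forall fun x => by simp)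
  have hreal : ∀ n, starRingEnd ℂ (fourierCoeff f n) = fourierCoeff f n := by
    intro n
    rcases lt_or_ge 0 n with hn | hn
    · rw [fourierCoeff_hardyLp_of_pos hc hn, map_zero]
    · obtain ⟨t, rfl⟩ : ∃ t : ℕ, n = -(t : ℤ) := ⟨n.natAbs, by omega⟩
      rw [fourierCoeff_hardyLp hc, Complex.conj_ofReal]
  have key : (fun x => f (-x) - starRingEnd ℂ (f x)) =ᵐ[freqMeasure] 0 := by
    refine ae_eq_zero_of_fourierCoeff_eq_zero (hneg.sub hconj) fun n => ?_
    have h1 : ∫ x, fourier (-n) x • f (-x) ∂freqMeasure = fourierCoeff f (-n) := by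
      rw [fourierCoeff, ← integral_neg_eq_self]
      refine integral_congr_ae (Eventually.of_forall fun x => ?_)
      simp [fourier_apply]
    have h2 : ∫ x, fourier (-n) x • starRingEnd ℂ (f x) ∂freqMeasure = fourierCoeff f (-n) := by
      rw [← hreal, fourierCoeff, ← integral_conj]
      refine integral_congr_ae (Eventually.of_forall fun x => ?_)
      simp only [smul_eq_mul, map_mul, ← fourier_neg, neg_neg]
    simp only [fourierCoeff, smul_sub]
    rw [integral_sub (hneg.fourier_smul _) (hconj.fourier_smul _), h1, h2, sub_self]
  filter_upwards [key] with x hx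
  exact sub_eq_zero.1 hx

theorem freqSq_neg {m p : ℕ} {H : CausalFilter m p} (hH : energy H < ⊤) :
    ∀ᵐ x ∂freqMeasure, freqSq H (-x) = freqSq H x := by
  have h := ae_all_iff.2 fun i => ae_all_iff.2 fun j =>
    conj_hardyLp_neg (c := fun t => H t i j) (summable_entry hH i j)
  filter_upwards [h] with x hx
  simp only [freqSq, freqLp_eq, hx, RCLike.norm_conj]

/-- The filter with one input and one output whose transfer function is the outer function of
boundary modulus `exp g`. -/
noncomputable def outerFilter (g : Freq → ℝ) : CausalFilter 1 1 :=
  fun t => Matrix.of fun _ _ => (outerCoeff g t).re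

theorem outerFilter_apply {g : Freq → ℝ} (hg : ∀ᵐ x ∂freqMeasure, g (-x) = g x) (t : ℕ)
    (i j : Fin 1) : (outerFilter g t i j : ℂ) = outerCoeff g t :=
  Complex.conj_eq_iff_re.1 (conj_outerCoeff hg t)

theorem isLeftInverse_outerFilter {g : Freq → ℝ} (hg : Integrable g freqMeasure)
    (hsymm : ∀ᵐ x ∂freqMeasure, g (-x) = g x) :
    IsLeftInverse (outerFilter (-g)) (outerFilter g) := by
  have hsymm' : ∀ᵐ x ∂freqMeasure, (-g) (-x) = (-g) x := by
    filter_upwards [hsymm] with x hx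
    simp [hx]
  funext t
  ext i j
  apply Complex.ofReal_injective
  rw [ofReal_comp_entry]
  simp only [outerFilter_apply hsymm, outerFilter_apply hsymm', Fin.sum_univ_one]
  rw [conv_outerCoeff_neg hg]
  by_cases ht : t = 0
  · obtain rfl := Subsingleton.elim i j
    simp [ht, CausalFilter.one]
  · simp [ht, CausalFilter.one]

theorem energy_comp_outerFilter_le {p : ℕ} {F : CausalFilter 1 p} (hF : energy F < ⊤)
    {g : Freq → ℝ} (hg : Integrable g freqMeasure) (hsymm : ∀ᵐ x ∂freqMeasure, g (-x) = g x) :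
    energy (F.comp (outerFilter g)) ≤
      ∫⁻ x, ENNReal.ofReal (freqSq F x * Real.exp (2 * g x)) ∂freqMeasure := by
  have hme : AEMeasurable (fun x => ENNReal.ofReal (Real.exp (2 * g x))) freqMeasure :=
    (Real.measurable_exp.comp_aemeasurable (hg.aemeasurable.const_mul 2)).ennreal_ofReal
  have h1 : ∀ x, ENNReal.ofReal (freqSq F x * Real.exp (2 * g x)) =
      ∑ i, ‖freqLp F i 0 x‖ₑ ^ 2 * ENNReal.ofReal (Real.exp (2 * g x)) := by
    intro x
    rw [ENNReal.ofReal_mul (freqSq_nonneg F x), freqSq, ← Finset.sum_mul]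
    simp only [Fin.sum_univ_one]
    rw [ENNReal.ofReal_sum_of_nonneg fun i _ => sq_nonneg _]
    simp only [ENNReal.ofReal_pow (norm_nonneg _), ofReal_norm]
  simp only [h1]
  have h2 : ∀ i, AEMeasurable
      (fun x => ‖freqLp F i 0 x‖ₑ ^ 2 * ENNReal.ofReal (Real.exp (2 * g x))) freqMeasure := fun i =>
    ((Lp.stronglyMeasurable _).enorm.pow_const 2).aemeasurable.mul hme
  rw [lintegral_finsetSum' _ fun i _ => h2 i, energy_eq_sum]
  refine Finset.sum_le_sum fun i _ => ?_
  simp only [Fin.sum_univ_one, ofReal_comp_entry, outerFilter_apply hsymm]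
  exact tsum_conv_outerCoeff_le (summable_entry hF i 0) hg

theorem energy_one_lt_top : energy (CausalFilter.one 1) < ⊤ := by
  rw [energy, tsum_eq_single 0]
  · exact ENNReal.ofReal_lt_top
  · intro t ht
    simp [CausalFilter.one, ht]

theorem freqSq_one : ∀ᵐ x ∂freqMeasure, freqSq (CausalFilter.one 1) x = 1 := by
  have h : hardyLp (fun t => (CausalFilter.one 1 t 0 0 : ℂ)) =ᵐ[freqMeasure] fun _ => 1 := by
    have h0 : ∀ t ≠ 0, CausalFilter.one 1 t 0 0 = 0 := fun t ht => by simp [CausalFilter.one, ht]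
    refine hardyLp_eq_of_hasSum ?_ fun x => ?_
    · exact summable_of_ne_finset_zero (s := {0}) fun t ht => by
        rw [h0 t (by simpa using ht)]; simp
    · convert! hasSum_single (f := fun n => ((CausalFilter.one 1 n 0 0 : ℝ) : ℂ) * unitPt x ^ n) 0
        fun t ht => by rw [h0 t ht, Complex.ofReal_zero, zero_mul]
      simp [CausalFilter.one]
  filter_upwards [h] with x hx
  simp only [freqSq, Fin.sum_univ_one, freqLp_eq]
  rw [hx]
  simp

/-- The exponent `½ ln |F|₂` of the optimal pre-filter. -/
noncomputable def halfLog {p : ℕ} (F : CausalFilter 1 p) (x : Freq) : ℝ :=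
  1 / 2 * Real.log (Real.sqrt (freqSq F x))

theorem exp_two_halfLog {p : ℕ} {F : CausalFilter 1 p} {x : Freq} (hx : 0 < freqSq F x) :
    Real.exp (2 * halfLog F x) = Real.sqrt (freqSq F x) := by
  rw [halfLog, show 2 * (1 / 2 * Real.log (Real.sqrt (freqSq F x))) =
    Real.log (Real.sqrt (freqSq F x)) by ring, Real.exp_log (Real.sqrt_pos.2 hx)]

theorem PaleyWiener.ae_pos {p : ℕ} {F : CausalFilter 1 p} (h : PaleyWiener F) :
    ∀ᵐ x ∂freqMeasure, 0 < freqSq F x := by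
  refine ae_of_ae_coe (measurableSet_lt measurable_const (measurable_freqSq F)) ?_
  filter_upwards [h.1] with ω hω
  rw [freqNorm_eq] at hω
  exact Real.sqrt_pos.1 hω

theorem PaleyWiener.integrable_halfLog {p : ℕ} {F : CausalFilter 1 p} (h : PaleyWiener F) :
    Integrable (halfLog F) freqMeasure := by
  refine Integrable.const_mul ?_ _
  refine (integrableOn_coe_iff (measurable_freqSq F).sqrt.log).1 ?_
  simpa only [freqNorm_eq] using h.2

theorem halfLog_neg {p : ℕ} {F : CausalFilter 1 p} (hF : energy F < ⊤) :
    ∀ᵐ x ∂freqMeasure, halfLog F (-x) = halfLog F x := by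
  filter_upwards [freqSq_neg hF] with x hx
  rw [halfLog, hx, halfLog]

/-- The optimal pre-filter has at most the energy `∫ |F|`. -/
theorem energy_outerFilter_le {p : ℕ} {F : CausalFilter 1 p} (hF : energy F < ⊤)
    (h : PaleyWiener F) : energy (outerFilter (halfLog F)) ≤
      ENNReal.ofReal (∫ x, Real.sqrt (freqSq F x) ∂freqMeasure) := by
  have h1 := energy_comp_outerFilter_le energy_one_lt_top h.integrable_halfLog (halfLog_neg hF)
  rw [one_comp] at h1
  rw [ofReal_integral_eq_lintegral_ofReal (integrable_sqrt_freqSq F)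
    (Eventually.of_forall fun x => Real.sqrt_nonneg _)]
  refine h1.trans_eq (lintegral_congr_ae ?_)
  filter_upwards [freqSq_one, h.ae_pos] with x hx hpos
  rw [hx, one_mul, exp_two_halfLog hpos]

/-- The equalizer `F / G` of the optimal pre-filter has at most the energy `∫ |F|² / |F| = ∫ |F|`. -/
theorem energy_comp_outerFilter_neg_le {p : ℕ} {F : CausalFilter 1 p} (hF : energy F < ⊤)
    (h : PaleyWiener F) : energy (F.comp (outerFilter (-halfLog F))) ≤
      ENNReal.ofReal (∫ x, Real.sqrt (freqSq F x) ∂freqMeasure) := by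
  have h1 := energy_comp_outerFilter_le hF h.integrable_halfLog.neg (by
    filter_upwards [halfLog_neg hF] with x hx
    rw [Pi.neg_apply, Pi.neg_apply, hx])
  rw [ofReal_integral_eq_lintegral_ofReal (integrable_sqrt_freqSq F)
    (Eventually.of_forall fun x => Real.sqrt_nonneg _)]
  refine h1.trans_eq (lintegral_congr_ae ?_)
  filter_upwards [h.ae_pos] with x hpos
  rw [Pi.neg_apply, mul_neg, Real.exp_neg, exp_two_halfLog hpos, ← div_eq_mul_inv,
    Real.div_sqrt]

/-- Equality in the Cauchy–Schwarz inequality: if the energies of `M` and of `G` are at most the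
integral of the modulus of `M G`, then `|G|² = |M G|` and the product of the energies is minimal. -/
theorem energy_mul_energy_eq {m q p : ℕ} {M : CausalFilter q p} {G : CausalFilter m q} {I : ℝ}
    (hMG : energy (M.comp G) < ⊤) (hI : I = ∫ x, Real.sqrt (freqSq (M.comp G) x) ∂freqMeasure)
    (hM : energy M ≤ ENNReal.ofReal I) (hG : energy G ≤ ENNReal.ofReal I) :
    energy G * energy M = ENNReal.ofReal (I ^ 2) ∧
      ∀ᵐ x ∂freqMeasure, freqSq G x = Real.sqrt (freqSq (M.comp G) x) := by
  have hM' : energy M < ⊤ := hM.trans_lt ENNReal.ofReal_lt_top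
  have hG' : energy G < ⊤ := hG.trans_lt ENNReal.ofReal_lt_top
  have hI0 : 0 ≤ I := hI ▸ integral_nonneg fun x => Real.sqrt_nonneg _
  have hle := sq_integral_le hM' hG' hMG
  rw [← hI] at hle
  rw [energy_eq_integral hM', ENNReal.ofReal_le_ofReal_iff hI0] at hM
  rw [energy_eq_integral hG', ENNReal.ofReal_le_ofReal_iff hI0] at hG
  have ha : 0 ≤ ∫ x, freqSq M x ∂freqMeasure := integral_nonneg (freqSq_nonneg M)
  have hb : 0 ≤ ∫ x, freqSq G x ∂freqMeasure := integral_nonneg (freqSq_nonneg G)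
  refine ⟨?_, ?_⟩
  · rw [energy_eq_integral hM', energy_eq_integral hG', ← ENNReal.ofReal_mul hb]
    congr 1
    refine le_antisymm ?_ (hle.trans_eq (mul_comm _ _))
    rw [sq]
    exact mul_le_mul hG hM ha hI0
  · have i1 : Integrable (fun x => freqSq M x + freqSq G x) freqMeasure :=
      (integrable_freqSq M).add (integrable_freqSq G)
    have i2 : Integrable (fun x => 2 * Real.sqrt (freqSq (M.comp G) x)) freqMeasure :=
      (integrable_sqrt_freqSq (M.comp G)).const_mul 2
    have i3 : Integrable (fun x => freqSq M x + freqSq G x -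
      2 * Real.sqrt (freqSq (M.comp G) x)) freqMeasure := i1.sub i2
    have hcs := sqrt_freqSq_comp_le hM' hG' hMG
    have hnn : 0 ≤ᵐ[freqMeasure] fun x => freqSq M x + freqSq G x -
        2 * Real.sqrt (freqSq (M.comp G) x) := by
      filter_upwards [hcs] with x hx
      have h2 := Real.sq_sqrt (freqSq_nonneg M x)
      have h3 := Real.sq_sqrt (freqSq_nonneg G x)
      show (0 : ℝ) ≤ _
      nlinarith [sq_nonneg (Real.sqrt (freqSq M x) - Real.sqrt (freqSq G x))]
    have hzero : ∫ x, (freqSq M x + freqSq G x -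
        2 * Real.sqrt (freqSq (M.comp G) x)) ∂freqMeasure = 0 := by
      refine le_antisymm ?_ (integral_nonneg_of_ae hnn)
      rw [integral_sub i1 i2, integral_add (integrable_freqSq M) (integrable_freqSq G),
        integral_const_mul, ← hI]
      linarith
    filter_upwards [hcs, (integral_eq_zero_iff_of_nonneg_ae hnn i3).1 hzero] with x hx hx0
    rw [Pi.zero_apply] at hx0
    have h2 := Real.sq_sqrt (freqSq_nonneg M x)
    have h3 := Real.sq_sqrt (freqSq_nonneg G x)
    -- `(√|M|² - √|G|²)² ≤ |M|² + |G|² - 2 |M G| = 0`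
    have h4 : (Real.sqrt (freqSq M x) - Real.sqrt (freqSq G x)) ^ 2 ≤ 0 := by nlinarith
    have h5 : Real.sqrt (freqSq M x) = Real.sqrt (freqSq G x) :=
      sub_eq_zero.1 (pow_eq_zero_iff two_ne_zero |>.1 (le_antisymm h4 (sq_nonneg _)))
    rw [h5] at h2
    linarith

theorem norm_freqResponse_sq (G : CausalFilter 1 1) (ω : ℝ) :
    ‖freqResponse G ω 0 0‖ ^ 2 = freqSq G (ω : Freq) := by
  simp only [freqSq, Fin.sum_univ_one]
  rfl

/-- An outer filter whose frequency response has the prescribed modulus `exp g` is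
minimum phase. -/
theorem isMinimumPhase_outerFilter {g : Freq → ℝ} (hgm : Measurable g)
    (hg : Integrable g freqMeasure) (hsymm : ∀ᵐ x ∂freqMeasure, g (-x) = g x)
    (hmod : ∀ᵐ x ∂freqMeasure, freqSq (outerFilter g) x = Real.exp (2 * g x)) :
    IsMinimumPhase (outerFilter g) := by
  have hlog : ∀ᵐ x ∂freqMeasure, Real.sqrt (freqSq (outerFilter g) x) = Real.exp (g x) := by
    filter_upwards [hmod] with x hx
    rw [hx, mul_comm, Real.exp_mul, Real.rpow_two, Real.sqrt_sq (Real.exp_pos _).le]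
  refine ⟨⟨?_, ?_⟩, 1, norm_one, fun z hz => ?_⟩
  · filter_upwards [ae_coe hlog] with ω hω
    rw [freqNorm_eq, hω]
    exact Real.exp_pos _
  · have h1 := (integrableOn_coe_iff hgm).2 hg
    refine Integrable.congr h1 ?_
    filter_upwards [ae_coe hlog] with ω hω
    rw [freqNorm_eq, hω, Real.log_exp]
  · have hz0 : z ≠ 0 := by
      rintro rfl
      rw [norm_zero] at hz
      linarith
    have hζ : ‖z⁻¹‖ < 1 := by
      rw [norm_inv]
      exact inv_lt_one_of_one_lt₀ hz
    have h1 := hasSum_outerCoeff hg hζ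
    have h2 : (fun t : ℕ => (outerFilter g t 0 0 : ℂ) * z⁻¹ ^ t) =
        fun t => outerCoeff g t * z⁻¹ ^ t := by
      funext t
      rw [outerFilter_apply hsymm]
    have h3 : herglotz g z⁻¹ = (1 / (2 * Real.pi) : ℝ) * ∫ ω in (-Real.pi)..Real.pi,
        (z + Complex.exp (ω * Complex.I)) / (z - Complex.exp (ω * Complex.I)) *
          (Real.log ‖freqResponse (outerFilter g) ω 0 0‖ : ℂ) := by
      have h4 := intervalIntegral_coe (E := ℂ) fun x =>
        (z + fourier 1 x) / (z - fourier 1 x) *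
          ((Real.log ‖freqLp (outerFilter g) 0 0 x‖ : ℝ) : ℂ)
      have h5 : ∀ ω : ℝ, fourier 1 (ω : Freq) = Complex.exp (ω * Complex.I) := by
        intro ω
        rw [fourier_coe_apply]
        congr 1
        have : (Real.pi : ℂ) ≠ 0 := by exact_mod_cast Real.pi_ne_zero
        push_cast
        field_simp
      simp only [h5, Complex.real_smul] at h4
      refine Eq.trans ?_ h4.symm
      refine integral_congr_ae ?_
      filter_upwards [hlog] with x hx
      have h6 : ‖freqLp (outerFilter g) 0 0 x‖ = Real.sqrt (freqSq (outerFilter g) x) := by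
        simp only [freqSq, Fin.sum_univ_one]
        exact (Real.sqrt_sq (norm_nonneg _)).symm
      rw [h6, hx, Real.log_exp]
      congr 1
      have h7 : z - fourier 1 x ≠ 0 := by
        intro h
        have := norm_fourier_apply 1 x
        rw [← sub_eq_zero.1 h] at this
        linarith
      have h8 := one_sub_mul_fourier_ne_zero hζ x
      rw [div_eq_div_iff h8 h7]
      field_simp
    rw [h2, one_mul, ← h3]
    exact h1

end ZFE

theorem theorem6 {p : ℕ} (F : ZFE.CausalFilter 1 p) (hF : ZFE.h2Norm F < ⊤)
    (k₁ δ ε : ℝ) (hk : 0 < k₁) (hδ : 0 < δ) (hδ' : δ < 1) (hε : 0 < ε) :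
    (∀ (q : ℕ) (G : ZFE.CausalFilter 1 q), ZFE.IsStableFilter G →
      ∀ L : ZFE.CausalFilter q 1, ZFE.IsLeftInverse L G →
        ∃ e : ENNReal, ZFE.HasMSE.{u} k₁ δ ε F G L e ∧
          ENNReal.ofReal (ZFE.mseBound k₁ δ ε F) ≤ e) ∧
    (ZFE.PaleyWiener F →
      ∃ G : ZFE.CausalFilter 1 1, ZFE.IsStableFilter G ∧ ZFE.IsMinimumPhase G ∧
        (∀ᵐ ω ∂MeasureTheory.volume.restrict (Set.Ico (-Real.pi) Real.pi),
          ‖ZFE.freqResponse G ω 0 0‖ ^ 2 = ZFE.freqNorm F ω) ∧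
        ∃ L : ZFE.CausalFilter 1 1, ZFE.IsLeftInverse L G ∧
          ZFE.HasMSE.{u} k₁ δ ε F G L (ENNReal.ofReal (ZFE.mseBound k₁ δ ε F))) := by
  have hF' := (ZFE.h2Norm_lt_top_iff F).1 hF
  refine ⟨fun q G hG L hLG => ⟨_, ZFE.hasMSE F hLG, ZFE.ofReal_mseBound_le hk hε hF' hG hLG⟩,
    fun hPW => ?_⟩
  have hint := hPW.integrable_halfLog
  have hsymm := ZFE.halfLog_neg hF'
  have hLG := ZFE.isLeftInverse_outerFilter hint hsymm
  have hc : (F.comp (ZFE.outerFilter (-ZFE.halfLog F))).comp (ZFE.outerFilter (ZFE.halfLog F)) =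
      F := by
    rw [ZFE.comp_assoc, hLG, ZFE.comp_one]
  have hEG := ZFE.energy_outerFilter_le hF' hPW
  obtain ⟨hprod, hmod⟩ := ZFE.energy_mul_energy_eq
    (M := F.comp (ZFE.outerFilter (-ZFE.halfLog F))) (G := ZFE.outerFilter (ZFE.halfLog F))
    (by rwa [hc]) (by rw [hc]) (ZFE.energy_comp_outerFilter_neg_le hF' hPW) hEG
  rw [hc] at hmod
  have hG : ZFE.IsStableFilter (ZFE.outerFilter (ZFE.halfLog F)) :=
    (ZFE.h2Norm_lt_top_iff _).2 (hEG.trans_lt ENNReal.ofReal_lt_top)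
  refine ⟨ZFE.outerFilter (ZFE.halfLog F), hG, ?_, ?_, ZFE.outerFilter (-ZFE.halfLog F), hLG, ?_⟩
  · refine ZFE.isMinimumPhase_outerFilter ((ZFE.measurable_freqSq F).sqrt.log.const_mul _) hint hsymm
      ?_
    filter_upwards [hmod, hPW.ae_pos] with x hx hpos
    rw [hx, ZFE.exp_two_halfLog hpos]
  · filter_upwards [ZFE.ae_coe hmod] with ω hω
    rw [ZFE.norm_freqResponse_sq, hω, ZFE.freqNorm_eq]
  · have h := ZFE.hasMSE.{u} (k₁ := k₁) (δ := δ) (ε := ε) F hLG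
    rwa [ZFE.noiseVariance_eq hk.le hG, mul_assoc, hprod, ← ENNReal.ofReal_mul (by positivity),
      ← ZFE.mseBound_eq] at h
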